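/- Conventions. A cube in $\mathbb R^n$ is a set $Q=\prod_{i=1}^n[x_i-h,x_i+h)$ with $h>0$; $3Q$ is the concentric cube of three times the side length, and $|\cdot|$ is Lebesgue measure. For a cube $Q$ put $\langle u\rangle_{r,Q}=\big(\frac1{|Q|}\int_Q |u|^r\big)^{1/r}$ and $\langle b\rangle_Q=\frac1{|Q|}\int_Q b$. All functions are real-valued, or all are complex-valued. $\mathscr D(Q)$ is the set of cubes obtained from $Q$ by repeated subdivision into $2^n$ congruent subcubes ($Q$ included). A dyadic lattice is a family $\mathscr D$ of cubes such that (i) $Q\in\mathscr D$ implies $\mathscr D(Q)\subset\mathscr D$; (ii) any $Q,Q'\in\mathscr D$ both belong to $\mathscr D(R)$ for some $R\in\mathscr D$; (iii) every compact set is contained in some $Q\in\mathscr D$. A family $\mathcal S$ of cubes is $\eta$-sparse if there are pairwise disjoint measurable sets $E_Q\subset Q$ ($Q\in\mathcal S$) with $|E_Q|\ge\eta|Q|$. Let $T$ be an operator defined at least on the functions in $L^{p_0}(\mathbb R^n)$ with bounded support. It is sublinear if $Tu$ is measurable for every such $u$ and, for every finite-dimensional space $V$ of such functions, for almost every $x$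 one has $|T(u+v)(x)|\le|Tu(x)|+|Tv(x)|$ and $|T(cu)(x)|=|c||Tu(x)|$ for all $u,v\in V$ and all scalars $c$. For $m\ge 0$ put $T_b^mf(x)=T\big((b(x)-b(\cdot))^mf\big)(x)$, so that $T_b^0f=Tf$. For $1\le s\le\infty$ let $$\mathcal M^{\#}_{T,s}f(x)=\sup_{Q\ni x}\Big(\frac1{|Q|^2}\int_{Q\times Q}|T(f\chi_{\mathbb R^n\setminus 3Q})(x')-T(f\chi_{\mathbb R^n\setminus3Q})(x'')|^s\,dx'\,dx''\Big)^{1/s},$$ the supremum being over all cubes $Q$ containing $x$ (with the essential supremum over $Q\times Q$ if $s=\infty$). For $0\le\alpha<n/p_0$, an operator $G$ is locally weak $L^{p_0}\to L^{p_0n/(n-\alpha p_0)}$ bounded with a non-increasing function $\varphi:(0,1)\to[0,\infty)$ if for all $\lambda\in(0,1)$, all cubes $Q$ and all $f\in L^{p_0}(Q)$ $$\big|\{x\in Q:|G(f\chi_Q)(x)|>\varphi(\lambda)\langle f\rangle_{p_0,Q}|Q|^{\alpha/n}\}\big|\le\lambda|Q|.$$ Theorem (sparse domination). Let $n\ge1$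 and $m\ge0$ be integers. There are constants $C_{m,n}>1$ and $0<\lambda_{m,n}<1$, depending only on $m$ and $n$, with the following property. Let $1\le p_0<q_0\le\infty$, $\frac1{q_0}+\frac1{q_0'}=1$, $0\le\alpha<n/p_0$. Let $T$ be a sublinear operator such that $T$ and $\mathcal M^{\#}_{T,q_0}$ are locally weak $L^{p_0}\to L^{p_0n/(n-\alpha p_0)}$ bounded, with functions $\varphi_T$ and $\varphi_{\mathcal M}$. Then for all bounded measurable functions $f,g$ with compact support and all $b\in L^1_{loc}(\mathbb R^n)$ there are a dyadic lattice $\mathscr D$ and a $\frac1{2\cdot3^n}$-sparse family $\mathcal S\subset\mathscr D$ such that $$\int_{\mathbb R^n}|T_b^mf||g|\,dx\le C\Big(\sum_{Q\in\mathcal S}\big\langle|b-\langle b\rangle_Q|^m|f|\big\rangle_{p_0,Q}\langle|g|\rangle_{q_0',Q}|Q|^{1+\frac\alpha n}+\sum_{Q\in\mathcal S}\langle|f|\rangle_{p_0,Q}\big\langle|b-\langle b\rangle_Q|^m|g|\big\rangle_{q_0',Q}|Q|^{1+\frac\alpha n}\Big),$$ where $C=C_{m,n}\big(\varphi_T(\lambda_{m,n})+\varphi_{\mathcal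 M}(\lambda_{m,n})\big)$. Here $0\cdot\infty=0$, with one exception: if $b^mf\notin L^{p_0}(\mathbb R^n)$ (then $T_b^mf$ need not be defined) and the sum in parentheses is infinite, the right-hand side is read as $+\infty$ even when $C=0$. -/

import Mathlib

open MeasureTheory Set
open scoped ENNReal NNReal

namespace SparseDom

/-- A cube `∏ i, [c i - h, c i + h)` in `ℝⁿ` with `h > 0`, given by its centre `c` and its
half side length `h`. -/
structure Cube (n : ℕ) where
  center : Fin n → ℝ
  half : ℝ
  half_pos : 0 < half

namespace Cube

variable {n : ℕ}

/-- The half-open cube as a set of points. -/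
def toSet (Q : Cube n) : Set (Fin n → ℝ) :=
  Set.pi Set.univ fun i => Set.Ico (Q.center i - Q.half) (Q.center i + Q.half)

/-- The concentric cube `3Q`. -/
def triple (Q : Cube n) : Cube n where
  center := Q.center
  half := 3 * Q.half
  half_pos := mul_pos three_pos Q.half_pos

/-- The Lebesgue measure `|Q|`. -/
noncomputable def vol (Q : Cube n) : ℝ≥0∞ := volume Q.toSet

/-- `R.IsChildOf Q`: `R` is one of the `2ⁿ` congruent cubes into which `Q` is subdivided. -/
def IsChildOf (R Q : Cube n) : Prop :=
  R.half = Q.half / 2 ∧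
    ∀ i, R.center i = Q.center i - Q.half / 2 ∨ R.center i = Q.center i + Q.half / 2

/-- The family `𝒟(Q)` of all cubes obtained by repeated subdivision of `Q` (including `Q`). -/
def descendants (Q : Cube n) : Set (Cube n) :=
  {R | Relation.ReflTransGen IsChildOf R Q}

end Cube

/-- Dyadic lattices. -/
structure IsDyadicLattice {n : ℕ} (D : Set (Cube n)) : Prop where
  descendants_subset : ∀ Q ∈ D, Q.descendants ⊆ D
  common_ancestor : ∀ Q ∈ D, ∀ Q' ∈ D, ∃ R ∈ D, Q ∈ R.descendants ∧ Q' ∈ R.descendants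
  exhausts : ∀ K : Set (Fin n → ℝ), IsCompact K → ∃ Q ∈ D, K ⊆ Q.toSet

/-- `η`-sparse families of cubes. -/
def IsSparse {n : ℕ} (η : ℝ) (S : Set (Cube n)) : Prop :=
  ∃ E : Cube n → Set (Fin n → ℝ),
    (∀ Q ∈ S, MeasurableSet (E Q) ∧ E Q ⊆ Q.toSet ∧ ENNReal.ofReal η * Q.vol ≤ volume (E Q)) ∧
    S.PairwiseDisjoint E

/-- The average `⟨|f|⟩_{r,Q} = (|Q|⁻¹ ∫_Q |f|^r)^{1/r}`, as an extended nonnegative real. -/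
noncomputable def avgNorm {n : ℕ} {F : Type*} [NormedAddCommGroup F]
    (r : ℝ≥0∞) (Q : Cube n) (f : (Fin n → ℝ) → F) : ℝ≥0∞ :=
  eLpNorm f r (Q.vol⁻¹ • volume.restrict Q.toSet)

/-- The oscillation `osc_s(h; Q) = (|Q|⁻² ∫_{Q×Q} |h(x') - h(x'')|^s dx' dx'')^{1/s}`, which is the
essential supremum of `|h(x') - h(x'')|` over `Q × Q` for `s = ∞`. -/
noncomputable def osc {n : ℕ} {F : Type*} [NormedAddCommGroup F]
    (s : ℝ≥0∞) (h : (Fin n → ℝ) → F) (Q : Cube n) : ℝ≥0∞ :=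
  eLpNorm (fun z : (Fin n → ℝ) × (Fin n → ℝ) => h z.1 - h z.2) s
    ((Q.vol ^ 2)⁻¹ • (volume : Measure ((Fin n → ℝ) × (Fin n → ℝ))).restrict (Q.toSet ×ˢ Q.toSet))

section Operators

variable {n : ℕ} {𝕜 : Type*} [RCLike 𝕜]

/-- The sharp grand maximal truncation operator: the supremum over all cubes `Q` containing `x`
of `osc_s(T(f χ_{ℝⁿ ∖ 3Q}); Q)`. -/
noncomputable def sharpMaximal (T : ((Fin n → ℝ) → 𝕜) → (Fin n → ℝ) → 𝕜) (s : ℝ≥0∞)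
    (f : (Fin n → ℝ) → 𝕜) (x : Fin n → ℝ) : ℝ≥0∞ :=
  ⨆ (Q : Cube n) (_ : x ∈ Q.toSet), osc s (T (Q.triple.toSetᶜ.indicator f)) Q

/-- The functions of class `L^p` vanishing outside a bounded set. -/
def BddSuppLp (p : ℝ≥0∞) (f : (Fin n → ℝ) → 𝕜) : Prop :=
  MemLp f p (volume : Measure (Fin n → ℝ)) ∧ Bornology.IsBounded (Function.support f)

/-- `T` is a sublinear operator on boundedly supported `L^p` functions: it sends them to measurable
functions, and `|T(u+v)| ≤ |Tu| + |Tv|`, `|T(cu)| = |c| |Tu|` almost everywhere.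
The exceptional null set is only allowed to depend on a finite-dimensional space of functions
containing `u` and `v`: the diagonal expression `T((b(x) - b(·))^m f)(x)` evaluates `T` at a function
that moves with `x` inside such a space. Operators for which the two relations hold at every point
are covered, and so are maximal operators whose value at `u` is infinite on a null set. The values of
`T` at other functions are irrelevant. -/
structure IsSublinear (p : ℝ≥0∞) (T : ((Fin n → ℝ) → 𝕜) → (Fin n → ℝ) → 𝕜) : Prop where
  measurable : ∀ f, BddSuppLp p f → AEStronglyMeasurable (T f) volume
  sublinear : ∀ V : Submodule 𝕜 ((Fin n → ℝ) → 𝕜), V.FG → (∀ u ∈ V, BddSuppLp p u) →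
    ∀ᵐ x, (∀ u ∈ V, ∀ v ∈ V, ‖T (u + v) x‖ ≤ ‖T u x‖ + ‖T v x‖) ∧
      ∀ c : 𝕜, ∀ u ∈ V, ‖T (c • u) x‖ = ‖c‖ * ‖T u x‖

/-- An operator, given through its absolute value `G f x` in `[0, ∞]`, is locally weak
`L^p → L^{pn/(n-αp)}` bounded with the non-increasing function `φ : (0,1) → [0,∞)`
(only the values of `φ` on `(0,1)` matter). -/
def IsLocallyWeakBounded (p : ℝ≥0∞) (α : ℝ) (φ : ℝ → ℝ≥0)
    (G : ((Fin n → ℝ) → 𝕜) → (Fin n → ℝ) → ℝ≥0∞) : Prop :=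
  AntitoneOn φ (Set.Ioo 0 1) ∧
    ∀ lam ∈ Set.Ioo (0 : ℝ) 1, ∀ (Q : Cube n) (f : (Fin n → ℝ) → 𝕜),
      MemLp f p (volume.restrict Q.toSet) →
      volume {x ∈ Q.toSet |
          (φ lam : ℝ≥0∞) * avgNorm p Q f * Q.vol ^ (α / n) < G (Q.toSet.indicator f) x}
        ≤ ENNReal.ofReal lam * Q.vol

/-- The iterated commutator `T_b^m f(x) = T((b(x) - b(·))^m f)(x)`. -/
def commutator (T : ((Fin n → ℝ) → 𝕜) → (Fin n → ℝ) → 𝕜) (b : (Fin n → ℝ) → 𝕜) (m : ℕ)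
    (f : (Fin n → ℝ) → 𝕜) (x : Fin n → ℝ) : 𝕜 :=
  T (fun y => (b x - b y) ^ m * f y) x

/-- The function `|b - ⟨b⟩_Q|^m |f|`. -/
noncomputable def oscWeight (b : (Fin n → ℝ) → 𝕜) (m : ℕ) (Q : Cube n) (f : (Fin n → ℝ) → 𝕜)
    (x : Fin n → ℝ) : ℝ :=
  ‖b x - ⨍ y in Q.toSet, b y‖ ^ m * ‖f x‖

/-- The sum of the two fractional sparse forms
`∑_{Q ∈ S} ⟨|b-⟨b⟩_Q|^m |f|⟩_{p,Q} ⟨|g|⟩_{r,Q} |Q|^{1+α/n}` and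
`∑_{Q ∈ S} ⟨|f|⟩_{p,Q} ⟨|b-⟨b⟩_Q|^m |g|⟩_{r,Q} |Q|^{1+α/n}`. -/
noncomputable def sparseForms (S : Set (Cube n)) (b : (Fin n → ℝ) → 𝕜) (m : ℕ) (p r : ℝ≥0∞) (α : ℝ)
    (f g : (Fin n → ℝ) → 𝕜) : ℝ≥0∞ :=
  (∑' Q : S, avgNorm p Q.1 (oscWeight b m Q.1 f) * avgNorm r Q.1 g * Q.1.vol ^ (1 + α / n)) +
    ∑' Q : S, avgNorm p Q.1 f * avgNorm r Q.1 (oscWeight b m Q.1 g) * Q.1.vol ^ (1 + α / n)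

end Operators

end SparseDom

/-! The proof is a stopping-time argument on a cube `Q` containing the supports of `f` and `g`. With
c the mean of b over 3Q and F_k = (b-c)^k f, the binomial theorem bounds the commutator by a
combination of the terms |b-c|^(m-k) |T F_k|, k ≤ m. The two weak type hypotheses and a maximal
function estimate produce an exceptional set E in Q with |E| ≤ 2^-(n+3) |Q|; off E, the values of
T(F_k χ_3Q), of its sharp maximal truncation and of the averages of F_k over triples of subcubes are
controlled by the average of F_k over 3Q. A Calderón–Zygmund decomposition (`exists_stopping_cubes`)
covers E, up to a null set, by disjoint cubes P of total measure at most |Q|/2, each with at most a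
quarter of its measure in E.

Off the cubes P the bound is direct. On P, f χ_3Q is split at 3P. The far part has controlled
oscillation on P, because P contains a point off E, and it is bounded on at least half of P by
sublinearity; Hölder's inequality then controls its pairing with g (`setLIntegral_enorm_mul_le_osc`,
`setLIntegral_far_part_le`). The part inside 3P is a commutator of the original kind, so it is left
intact and expanded later about the mean over 3P. This is `exists_stopping_family`.

Iteration yields a tree of cubes. Its generations shrink geometrically, so the recursion stops at
almost every point (`setLIntegral_le_tsum_tree`), and each cube minus its children supplies the
sparse sets. The terms with 0 < k < m reduce to the two extreme ones by interpolation
(`avgNorm_mul_avgNorm_le`). Finally the triples of the cubes are distributed over 3^n dyadic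
lattices, and the lattice with the largest sum is kept (`exists_sparse_lattice_family`). -/

namespace SparseDom

/-! ### Cubes and the dyadic grid generated by a cube -/

namespace Cube

variable {n : ℕ}

theorem mem_toSet {Q : Cube n} {x : Fin n → ℝ} :
    x ∈ Q.toSet ↔ ∀ i, Q.center i - Q.half ≤ x i ∧ x i < Q.center i + Q.half := by
  simp [toSet, Set.mem_pi]

theorem measurableSet_toSet (Q : Cube n) : MeasurableSet Q.toSet :=
  MeasurableSet.univ_pi fun _ => measurableSet_Ico

theorem vol_eq (Q : Cube n) : Q.vol = ENNReal.ofReal ((2 * Q.half) ^ n) := by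
  have h := Q.half_pos
  rw [vol, toSet, Real.volume_pi_Ico, ENNReal.ofReal_pow (by positivity)]
  simp only [Finset.prod_const, Finset.card_univ, Fintype.card_fin,
    show ∀ i, Q.center i + Q.half - (Q.center i - Q.half) = 2 * Q.half from fun i => by ring]

theorem vol_ne_zero (Q : Cube n) : Q.vol ≠ 0 := by
  have h := Q.half_pos
  rw [vol_eq, Ne, ENNReal.ofReal_eq_zero, not_le]
  positivity

theorem vol_ne_top (Q : Cube n) : Q.vol ≠ ∞ := by
  rw [vol_eq]; exact ENNReal.ofReal_ne_top

theorem center_mem (Q : Cube n) : Q.center ∈ Q.toSet :=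
  mem_toSet.2 fun i => by constructor <;> linarith [Q.half_pos]

theorem vol_triple (Q : Cube n) : Q.triple.vol = 3 ^ n * Q.vol := by
  have h := Q.half_pos
  rw [vol_eq, vol_eq, triple, show 2 * (3 * Q.half) = 3 * (2 * Q.half) by ring, mul_pow,
    ENNReal.ofReal_mul (by positivity), ENNReal.ofReal_pow (by positivity)]
  simp

theorem toSet_subset_iff {P Q : Cube n} : P.toSet ⊆ Q.toSet ↔
    ∀ i, Q.center i - Q.half ≤ P.center i - P.half ∧ P.center i + P.half ≤ Q.center i + Q.half := by
  have hP := P.half_pos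
  have hne : ¬ (univ.pi fun i => Ico (P.center i - P.half) (P.center i + P.half)) = ∅ := by
    rw [← Ne, ← Set.nonempty_iff_ne_empty]
    exact ⟨_, P.center_mem⟩
  rw [toSet, toSet, Set.pi_subset_pi_iff, or_iff_left hne]
  refine ⟨fun h i => ?_, fun h i _ => ?_⟩
  · exact (Set.Ico_subset_Ico_iff (by linarith)).1 (h i (mem_univ i))
  · exact (Set.Ico_subset_Ico_iff (by linarith)).2 (h i)

theorem subset_triple (Q : Cube n) : Q.toSet ⊆ Q.triple.toSet :=
  toSet_subset_iff.2 fun i => by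
    have := Q.half_pos
    constructor <;> simp only [triple] <;> linarith

theorem triple_subset_triple {P Q : Cube n} (h : P.toSet ⊆ Q.toSet) :
    P.triple.toSet ⊆ Q.triple.toSet := by
  rw [toSet_subset_iff] at h ⊢
  intro i
  have := h i
  constructor <;> simp only [triple] <;> linarith

theorem triple_injective : Function.Injective (triple : Cube n → Cube n) := by
  rintro ⟨c, h, hh⟩ ⟨c', h', hh'⟩ e
  simp only [triple, Cube.mk.injEq] at e
  have : h = h' := by linarith [e.2]
  simp [e.1, this]

theorem toSet_subset_closedBall (Q : Cube n) :
    Q.toSet ⊆ Metric.closedBall Q.center Q.half := by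
  intro x hx
  rw [mem_toSet] at hx
  rw [mem_closedBall_iff_norm, pi_norm_le_iff_of_nonneg Q.half_pos.le]
  intro i
  rw [Pi.sub_apply, Real.norm_eq_abs, abs_le]
  constructor <;> linarith [hx i]

theorem volume_closedBall_eq (Q : Cube n) :
    volume (Metric.closedBall Q.center Q.half) = Q.vol := by
  rw [vol_eq, Real.volume_pi_closedBall _ Q.half_pos.le, Fintype.card_fin]

/-- In the sup norm a cube is a ball up to part of its boundary. This makes density and Vitali
covering theorems for balls available for cubes. -/
theorem toSet_ae_eq_closedBall (Q : Cube n) :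
    (Q.toSet : Set (Fin n → ℝ)) =ᵐ[volume] Metric.closedBall Q.center Q.half :=
  ae_eq_of_subset_of_measure_ge Q.toSet_subset_closedBall (by rw [volume_closedBall_eq, vol])
    Q.measurableSet_toSet.nullMeasurableSet (by rw [volume_closedBall_eq]; exact Q.vol_ne_top)

theorem IsChildOf.subset {R Q : Cube n} (h : R.IsChildOf Q) : R.toSet ⊆ Q.toSet := by
  rw [toSet_subset_iff]
  intro i
  have hQ := Q.half_pos
  have h1 := h.1
  rcases h.2 i with h2 | h2 <;> constructor <;> rw [h1, h2] <;> linarith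

theorem descendants_self (Q : Cube n) : Q ∈ Q.descendants := Relation.ReflTransGen.refl

theorem subset_of_mem_descendants {R Q : Cube n} (h : R ∈ Q.descendants) :
    R.toSet ⊆ Q.toSet := by
  induction h with
  | refl => exact Subset.rfl
  | tail _ h ih => exact ih.trans h.subset

theorem mem_descendants_trans {P R Q : Cube n} (h : P ∈ R.descendants) (h' : R ∈ Q.descendants) :
    P ∈ Q.descendants :=
  Relation.ReflTransGen.trans h h'

/-- The integer coordinates, at scale `2⁻ᵏ`, of the grid cube of `Q` containing `x`. -/
noncomputable def gridIndex (Q : Cube n) (k : ℕ) (x : Fin n → ℝ) (i : Fin n) : ℤ :=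
  ⌊(x i - (Q.center i - Q.half)) / (2 * Q.half) * 2 ^ k⌋

/-- The cube of the dyadic grid of generation `k` generated by `Q` with given coordinates. -/
noncomputable def gridCube (Q : Cube n) (k : ℕ) (a : Fin n → ℤ) : Cube n where
  center := fun i => Q.center i - Q.half + (2 * a i + 1) * (Q.half / 2 ^ k)
  half := Q.half / 2 ^ k
  half_pos := div_pos Q.half_pos (by positivity)

/-- The cube of the dyadic grid of generation `k` generated by `Q` that contains `x`. -/
noncomputable def dyadicAt (Q : Cube n) (k : ℕ) (x : Fin n → ℝ) : Cube n :=
  Q.gridCube k (Q.gridIndex k x)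

/-- Half-open cubes match the floor function exactly, so each generation of the grid partitions the
whole space without exceptional points. -/
theorem mem_gridCube {Q : Cube n} {k : ℕ} {a : Fin n → ℤ} {x : Fin n → ℝ} :
    x ∈ (Q.gridCube k a).toSet ↔ Q.gridIndex k x = a := by
  have hQ := Q.half_pos
  have h2 : (0 : ℝ) < 2 ^ k := by positivity
  rw [mem_toSet, funext_iff]
  refine forall_congr' fun i => ?_
  rw [gridIndex, Int.floor_eq_iff]
  simp only [gridCube]
  have e : (x i - (Q.center i - Q.half)) / (2 * Q.half) * 2 ^ k =
      (x i - (Q.center i - Q.half)) / (2 * Q.half / 2 ^ k) := by field_simp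
  rw [e, le_div_iff₀ (by positivity), div_lt_iff₀ (by positivity)]
  have e2 : 2 * Q.half / 2 ^ k = 2 * (Q.half / 2 ^ k) := by ring
  rw [e2]
  constructor <;> rintro ⟨h1, h3⟩ <;> constructor <;> linarith

theorem mem_dyadicAt (Q : Cube n) (k : ℕ) (x : Fin n → ℝ) : x ∈ (Q.dyadicAt k x).toSet :=
  mem_gridCube.2 rfl

theorem dyadicAt_eq_of_mem {Q : Cube n} {k : ℕ} {x z : Fin n → ℝ}
    (h : z ∈ (Q.dyadicAt k x).toSet) : Q.dyadicAt k z = Q.dyadicAt k x := by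
  rw [dyadicAt, mem_gridCube.1 h]; rfl

theorem dyadicAt_zero {Q : Cube n} {x : Fin n → ℝ} (hx : x ∈ Q.toSet) : Q.dyadicAt 0 x = Q := by
  have hQ : Q = Q.gridCube 0 0 := by
    cases Q; simp [gridCube]
  rw [hQ, mem_gridCube] at hx
  rw [dyadicAt, hx, ← hQ]

theorem dyadicAt_succ_isChildOf (Q : Cube n) (k : ℕ) (x : Fin n → ℝ) :
    (Q.dyadicAt (k + 1) x).IsChildOf (Q.dyadicAt k x) := by
  refine ⟨by simp only [dyadicAt, gridCube, pow_succ]; field_simp, fun i => ?_⟩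
  simp only [dyadicAt, gridCube, gridIndex, pow_succ]
  set t := (x i - (Q.center i - Q.half)) / (2 * Q.half) * 2 ^ k with ht
  have e : (x i - (Q.center i - Q.half)) / (2 * Q.half) * (2 ^ k * 2) = t * 2 := by
    rw [ht]; ring
  rw [e]
  have h1 := Int.floor_le t
  have h2 := Int.lt_floor_add_one t
  have h : ⌊t * 2⌋ = 2 * ⌊t⌋ ∨ ⌊t * 2⌋ = 2 * ⌊t⌋ + 1 := by
    have h3 : 2 * ⌊t⌋ ≤ ⌊t * 2⌋ := Int.le_floor.2 (by push_cast; linarith)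
    have h4 : ⌊t * 2⌋ < 2 * ⌊t⌋ + 2 := Int.floor_lt.2 (by push_cast; linarith)
    omega
  have h2k : (2 : ℝ) ^ k ≠ 0 := by positivity
  rcases h with h | h <;> rw [h] <;> push_cast
  · left; field_simp; ring
  · right; field_simp; ring

theorem dyadicAt_anti {Q : Cube n} {j k : ℕ} (h : j ≤ k) (x : Fin n → ℝ) :
    Q.dyadicAt k x ∈ (Q.dyadicAt j x).descendants := by
  induction k, h using Nat.le_induction with
  | base => exact descendants_self _
  | succ k _ ih => exact Relation.ReflTransGen.head (Q.dyadicAt_succ_isChildOf k x) ih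

theorem dyadicAt_mem_descendants {Q : Cube n} {x : Fin n → ℝ} (hx : x ∈ Q.toSet) (k : ℕ) :
    Q.dyadicAt k x ∈ Q.descendants := by
  have h := dyadicAt_anti (Q := Q) (Nat.zero_le k) x
  rwa [dyadicAt_zero hx] at h

theorem exists_gridCube_of_mem_descendants {R Q : Cube n} (h : R ∈ Q.descendants) :
    ∃ (k : ℕ) (a : Fin n → ℤ), (∀ i, 0 ≤ a i ∧ a i < 2 ^ k) ∧ R = Q.gridCube k a := by
  induction h using Relation.ReflTransGen.head_induction_on with
  | refl => exact ⟨0, 0, by simp, by cases Q; simp [gridCube]⟩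
  | @head R P hRP _ ih =>
    obtain ⟨k, a, ha, rfl⟩ := ih
    have hc : ∀ i, ∃ e : ℤ, (e = 0 ∨ e = 1) ∧
        R.center i = Q.center i - Q.half + (2 * ((2 * a i + e : ℤ) : ℝ) + 1) *
          (Q.half / 2 ^ (k + 1)) := by
      intro i
      rcases hRP.2 i with h | h
      · refine ⟨0, Or.inl rfl, ?_⟩
        rw [h]; simp only [gridCube, pow_succ]; push_cast; field_simp; ring
      · refine ⟨1, Or.inr rfl, ?_⟩
        rw [h]; simp only [gridCube, pow_succ]; push_cast; field_simp; ring
    choose e he hc using hc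
    refine ⟨k + 1, fun i => 2 * a i + e i, fun i => ?_, ?_⟩
    · have := ha i
      beta_reduce
      rw [pow_succ]
      rcases he i with h | h <;> rw [h] <;> constructor <;> linarith
    · have hh : R.half = Q.half / 2 ^ (k + 1) := by
        rw [hRP.1]; simp only [gridCube, pow_succ]; field_simp
      obtain ⟨c, l, hl⟩ := R
      simp only at hc hh
      simp only [gridCube, Cube.mk.injEq]
      exact ⟨funext hc, hh⟩

theorem gridCube_mem_descendants {Q : Cube n} {k : ℕ} {a : Fin n → ℤ}
    (ha : ∀ i, 0 ≤ a i ∧ a i < 2 ^ k) : Q.gridCube k a ∈ Q.descendants := by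
  have hQ := Q.half_pos
  have hx : (Q.gridCube k a).center ∈ Q.toSet := by
    rw [mem_toSet]
    intro i
    simp only [gridCube]
    have h1 : (0 : ℝ) ≤ a i := by exact_mod_cast (ha i).1
    have h2 : (a i : ℝ) + 1 ≤ 2 ^ k := by exact_mod_cast (ha i).2
    have h3 : 0 < Q.half / 2 ^ k := by positivity
    have h4 : Q.half / 2 ^ k * 2 ^ k = Q.half := by field_simp
    constructor <;> nlinarith
  have := dyadicAt_mem_descendants hx k
  rwa [dyadicAt, mem_gridCube.1 (center_mem _)] at this

theorem countable_descendants (Q : Cube n) : Q.descendants.Countable := by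
  refine (Set.countable_range fun p : ℕ × (Fin n → ℤ) => Q.gridCube p.1 p.2).mono ?_
  intro R hR
  obtain ⟨k, a, _, rfl⟩ := exists_gridCube_of_mem_descendants hR
  exact ⟨(k, a), rfl⟩

/-! ### Dyadic lattices through a given cube, and the one-third trick -/

/-- The cube of twice the side length of `Q` which has `Q` as its child in a lower (for `s = -1`)
or an upper (for `s = 1`) corner. -/
noncomputable def doubled (Q : Cube n) (s : ℝ) : Cube n where
  center := fun i => Q.center i - s * Q.half
  half := 2 * Q.half
  half_pos := mul_pos two_pos Q.half_pos

theorem isChildOf_doubled (Q : Cube n) {s : ℝ} (hs : s = 1 ∨ s = -1) :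
    Q.IsChildOf (Q.doubled s) := by
  refine ⟨by simp [doubled], fun i => ?_⟩
  rcases hs with rfl | rfl
  · right; simp [doubled]
  · left; simp [doubled]

/-- An increasing chain of cubes starting at `Q`, alternately extended in opposite directions. -/
noncomputable def ancestor (Q : Cube n) : ℕ → Cube n
  | 0 => Q
  | k + 1 => (ancestor Q k).doubled ((-1) ^ k)

theorem ancestor_mem_descendants (Q : Cube n) {j k : ℕ} (h : j ≤ k) :
    Q.ancestor j ∈ (Q.ancestor k).descendants := by
  induction k, h using Nat.le_induction with
  | base => exact descendants_self _
  | succ k _ ih =>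
    exact Relation.ReflTransGen.tail ih (isChildOf_doubled _ (neg_one_pow_eq_or ℝ k))

/-- Doubling always towards the same corner would fill only an orthant. Alternating the direction
keeps the original cube well inside its ancestors, which therefore exhaust space. -/
theorem exists_lattice (Q : Cube n) : ∃ D : Set (Cube n), IsDyadicLattice D ∧ Q ∈ D := by
  refine ⟨⋃ k, (Q.ancestor k).descendants, ⟨?_, ?_, ?_⟩,
    mem_iUnion.2 ⟨0, descendants_self _⟩⟩
  · intro R hR P hP
    obtain ⟨k, hk⟩ := mem_iUnion.1 hR
    exact mem_iUnion.2 ⟨k, mem_descendants_trans hP hk⟩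
  · intro R hR P hP
    obtain ⟨k, hk⟩ := mem_iUnion.1 hR
    obtain ⟨j, hj⟩ := mem_iUnion.1 hP
    exact ⟨Q.ancestor (max k j), mem_iUnion.2 ⟨_, descendants_self _⟩,
      mem_descendants_trans hk (Q.ancestor_mem_descendants (le_max_left _ _)),
      mem_descendants_trans hj (Q.ancestor_mem_descendants (le_max_right _ _))⟩
  · intro K hK
    have hhalf : ∀ k, (Q.ancestor k).half = 2 ^ k * Q.half := by
      intro k
      induction k with
      | zero => simp [ancestor]
      | succ k ih => simp [ancestor, doubled, ih, pow_succ]; ring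
    have hQ := Q.half_pos
    have hcen : ∀ k i, (Q.ancestor (2 * k)).center i =
        Q.center i + (4 ^ k - 1) / 3 * Q.half := by
      intro k i
      induction k with
      | zero => simp [ancestor]
      | succ k ih =>
        have e : 2 * (k + 1) = 2 * k + 1 + 1 := by ring
        rw [e]
        simp only [ancestor, doubled, ih, hhalf]
        have h1 : ((-1 : ℝ)) ^ (2 * k) = 1 := by simp
        have h2 : ((-1 : ℝ)) ^ (2 * k + 1) = -1 := by rw [pow_succ, h1]; ring
        have h4 : (2 : ℝ) ^ (2 * k) = 4 ^ k := by rw [pow_mul]; norm_num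
        rw [h1, h2, pow_succ 4, h4]
        ring
    obtain ⟨r, hr⟩ := hK.isBounded.subset_closedBall Q.center
    -- The centre of ancestor 2k is displaced by about a third of its half side, so every face stays
    -- at distance at least (2/3) 4^k `Q.half` from `Q.center`.
    obtain ⟨k, hk⟩ := exists_nat_gt (3 * r / (2 * Q.half))
    refine ⟨Q.ancestor (2 * k), mem_iUnion.2 ⟨_, descendants_self _⟩, fun x hx => ?_⟩
    have hx' : ∀ i, |x i - Q.center i| ≤ r := by
      intro i
      have := hr hx
      rw [mem_closedBall_iff_norm] at this
      exact (norm_le_pi_norm (x - Q.center) i).trans this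
    rw [mem_toSet]
    intro i
    have h5 : (k : ℝ) < 4 ^ k := by exact_mod_cast Nat.lt_pow_self (by norm_num)
    rw [div_lt_iff₀ (by positivity)] at hk
    rw [hcen, hhalf]
    have h6 : (2 : ℝ) ^ (2 * k) = 4 ^ k := by rw [pow_mul]; norm_num
    rw [h6]
    have h7 := abs_le.1 (hx' i)
    have h8 : (k : ℝ) * (2 * Q.half) < 4 ^ k * (2 * Q.half) := by
      gcongr
    have h9 : Q.half ≤ 4 ^ k * Q.half :=
      le_mul_of_one_le_left hQ.le (one_le_pow₀ (by norm_num))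
    constructor <;> nlinarith

/-- The `3ⁿ` cubes, of six times the side length of `Q`, whose dyadic descendants comprise the
triples of all dyadic descendants of `Q`. -/
noncomputable def shifted (Q : Cube n) (j : Fin n → Fin 3) : Cube n where
  center := fun i => Q.center i - Q.half - 4 * (j i : ℕ) * Q.half + 6 * Q.half
  half := 6 * Q.half
  half_pos := mul_pos (by norm_num) Q.half_pos

/-- In units of the side of `R`, the lower corner of 3`R` has coordinate a - 1 + 2j 2^k relative to
the shifted cube, whose grid of generation k + 1 has step 3. Since 3 does not divide 2^k, the values
j = 0, 1, 2 cover all residues, so in each coordinate one choice aligns the triple with the grid. -/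
theorem exists_triple_mem_descendants_shifted {R Q : Cube n} (h : R ∈ Q.descendants) :
    ∃ j : Fin n → Fin 3, R.triple ∈ (Q.shifted j).descendants := by
  obtain ⟨k, a, ha, rfl⟩ := exists_gridCube_of_mem_descendants h
  have key : ∀ i, ∃ (j : Fin 3) (a' : ℤ), 3 * a' = a i - 1 + 2 * (j : ℕ) * 2 ^ k := by
    intro i
    have h3 : (2 : ℤ) ^ k % 3 = 1 ∨ (2 : ℤ) ^ k % 3 = 2 := by
      clear ha h
      induction k with
      | zero => simp
      | succ k ih => rw [pow_succ]; omega
    generalize (2 : ℤ) ^ k = t at h3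
    by_cases h0 : (a i - 1) % 3 = 0
    · exact ⟨0, (a i - 1) / 3, by simp; omega⟩
    by_cases h1 : (a i - 1 + 2 * t) % 3 = 0
    · exact ⟨1, (a i - 1 + 2 * t) / 3, by simp; omega⟩
    · exact ⟨2, (a i - 1 + 4 * t) / 3, by simp; omega⟩
  choose j a' hj using key
  refine ⟨j, ?_⟩
  have e : (Q.gridCube k a).triple = (Q.shifted j).gridCube (k + 1) a' := by
    simp only [triple, gridCube, shifted, Cube.mk.injEq]
    refine ⟨funext fun i => ?_, by rw [pow_succ]; field_simp; ring⟩
    have hj' : (3 : ℝ) * a' i = a i - 1 + 2 * (j i : ℕ) * 2 ^ k := by exact_mod_cast hj i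
    have : (a' i : ℝ) = (a i - 1 + 2 * (j i : ℕ) * 2 ^ k) / 3 := by linarith
    rw [this, pow_succ]
    field_simp
    ring
  rw [e]
  refine gridCube_mem_descendants fun i => ?_
  have h1 := ha i
  have h2 := hj i
  have h3 : ((j i : ℕ) : ℤ) = 0 ∨ ((j i : ℕ) : ℤ) = 1 ∨ ((j i : ℕ) : ℤ) = 2 := by
    have := (j i).2
    omega
  rw [pow_succ]
  generalize (2 : ℤ) ^ k = t at *
  rcases h3 with h3 | h3 | h3 <;> rw [h3] at h2 <;> omega

end Cube

end SparseDom

/-! ### Stopping cubes and the maximal function over triples -/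

namespace SparseDom

namespace Cube

variable {n : ℕ}

theorem vol_eq_two_pow_mul {R Q : Cube n} (h : R.IsChildOf Q) : Q.vol = 2 ^ n * R.vol := by
  have hQ := Q.half_pos
  rw [vol_eq, vol_eq, h.1, show 2 * Q.half = 2 * (2 * (Q.half / 2)) by ring, mul_pow,
    ENNReal.ofReal_mul (by positivity), ENNReal.ofReal_pow (zero_le_two : (0 : ℝ) ≤ 2)]
  simp

theorem countable_of_subset_descendants {Q : Cube n} {S : Set (Cube n)}
    (h : S ⊆ Q.descendants) : S.Countable :=
  Q.countable_descendants.mono h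

/-- Lebesgue density along the dyadic grid of `Q`. -/
theorem ae_exists_dyadicAt_density (Q : Cube n) (E : Set (Fin n → ℝ)) :
    ∀ᵐ x ∂volume.restrict E, ∃ k, (Q.dyadicAt k x).vol <
      2 * volume ((Q.dyadicAt k x).toSet ∩ E) := by
  have hd := IsUnifLocDoublingMeasure.ae_tendsto_measure_inter_div
    (volume : Measure (Fin n → ℝ)) E 1
  filter_upwards [hd] with x hx
  have hQ := Q.half_pos
  have h0 : Filter.Tendsto (fun k : ℕ => (Q.dyadicAt k x).half) Filter.atTop
      (nhdsWithin 0 (Set.Ioi 0)) := by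
    refine tendsto_nhdsWithin_iff.2 ⟨?_, Filter.Eventually.of_forall fun k => ?_⟩
    · simp only [dyadicAt, gridCube]
      have := (tendsto_pow_atTop_nhds_zero_of_lt_one (r := (1 / 2 : ℝ)) (by norm_num)
        (by norm_num)).const_mul Q.half
      simpa [div_eq_mul_inv] using this
    · exact (Q.dyadicAt k x).half_pos
  have h1 := hx (fun k : ℕ => (Q.dyadicAt k x).center) (fun k => (Q.dyadicAt k x).half) h0
    (Filter.Eventually.of_forall fun k => by
      rw [one_mul]; exact toSet_subset_closedBall _ (mem_dyadicAt Q k x))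
  obtain ⟨k, hk⟩ := (h1.eventually (lt_mem_nhds (show (2⁻¹ : ℝ≥0∞) < 1 by
    simp))).exists
  refine ⟨k, ?_⟩
  rw [volume_closedBall_eq, ENNReal.lt_div_iff_mul_lt (Or.inl (vol_ne_zero _))
    (Or.inl (vol_ne_top _))] at hk
  have e : volume (E ∩ Metric.closedBall (Q.dyadicAt k x).center (Q.dyadicAt k x).half) =
      volume ((Q.dyadicAt k x).toSet ∩ E) := by
    rw [inter_comm]
    exact measure_congr ((toSet_ae_eq_closedBall _).symm.inter (ae_eq_refl E))
  rw [e] at hk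
  calc (Q.dyadicAt k x).vol = 2 * (2⁻¹ * (Q.dyadicAt k x).vol) := by
        rw [← mul_assoc, ENNReal.mul_inv_cancel (by simp) (by simp), one_mul]
    _ < _ := by
        rw [ENNReal.mul_lt_mul_iff_right (by simp) (by simp)]
        exact hk

/-- The local Calderón–Zygmund decomposition of a set of small measure. -/
theorem exists_stopping_cubes (Q : Cube n) {E : Set (Fin n → ℝ)} (hE : MeasurableSet E)
    (hEQ : E ⊆ Q.toSet) (hvol : 2 ^ (n + 3) * volume E ≤ Q.vol) :
    ∃ S ⊆ Q.descendants, S.PairwiseDisjoint toSet ∧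
      2 * volume (⋃ P ∈ S, P.toSet) ≤ Q.vol ∧
      (∀ P ∈ S, 4 * volume (P.toSet ∩ E) ≤ P.vol) ∧
      volume (E \ ⋃ P ∈ S, P.toSet) = 0 := by
  -- The family consists of the maximal bad cubes. The threshold is half of 2^(n+3), which makes
  -- their total measure at most |Q|/2 and keeps `Q` itself from being bad.
  let bad : Cube n → Prop := fun P => P.vol < 2 ^ (n + 2) * volume (P.toSet ∩ E)
  have hQbad : ¬ bad Q := by
    simp only [bad, not_lt]
    refine le_trans ?_ hvol
    gcongr
    · norm_num
    · norm_num
    · exact inter_subset_right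
  let S : Set (Cube n) := {P | ∃ x ∈ Q.toSet, ∃ k, P = Q.dyadicAt k x ∧ bad (Q.dyadicAt k x) ∧
    ∀ j < k, ¬ bad (Q.dyadicAt j x)}
  have hSQ : S ⊆ Q.descendants := by
    rintro P ⟨x, hx, k, rfl, -, -⟩
    exact dyadicAt_mem_descendants hx k
  have hSc : S.Countable := countable_of_subset_descendants hSQ
  have hdisj : S.PairwiseDisjoint toSet := by
    rintro P ⟨x, hx, k, rfl, hb, hk⟩ P' ⟨x', hx', k', rfl, hb', hk'⟩ hne
    refine Set.disjoint_left.2 fun z hz hz' => hne ?_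
    have h1 : ∀ j ≤ k, Q.dyadicAt j z = Q.dyadicAt j x := fun j hj =>
      dyadicAt_eq_of_mem (subset_of_mem_descendants (dyadicAt_anti hj x) hz)
    have h2 : ∀ j ≤ k', Q.dyadicAt j z = Q.dyadicAt j x' := fun j hj =>
      dyadicAt_eq_of_mem (subset_of_mem_descendants (dyadicAt_anti hj x') hz')
    rcases lt_trichotomy k k' with h | h | h
    · exact absurd (by rw [← h2 k h.le, h1 k le_rfl]; exact hb) (hk' k h)
    · rw [← h1 k le_rfl, h, h2 k' le_rfl]
    · exact absurd (by rw [← h1 k' h.le, h2 k' le_rfl]; exact hb') (hk k' h)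
  refine ⟨S, hSQ, hdisj, ?_, ?_, ?_⟩
  · rw [measure_biUnion hSc hdisj fun P _ => P.measurableSet_toSet]
    have h1 : ∑' P : S, volume (P : Cube n).toSet ≤
        ∑' P : S, 2 ^ (n + 2) * volume ((P : Cube n).toSet ∩ E) := by
      refine ENNReal.tsum_le_tsum fun P => ?_
      obtain ⟨x, hx, k, h, hb, -⟩ := P.2
      rw [h]
      exact le_of_lt hb
    rw [ENNReal.tsum_mul_left, ← measure_biUnion hSc (hdisj.mono fun P => inter_subset_left)
      fun P _ => P.measurableSet_toSet.inter hE] at h1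
    calc _ ≤ 2 * (2 ^ (n + 2) * volume (⋃ P ∈ S, P.toSet ∩ E)) := by gcongr
      _ ≤ 2 * (2 ^ (n + 2) * volume E) := by
          gcongr
          exact iUnion₂_subset fun P _ => inter_subset_right
      _ = 2 ^ (n + 3) * volume E := by rw [pow_succ 2 (n + 2)]; ring
      _ ≤ _ := hvol
  · rintro P ⟨x, hx, k, rfl, hb, hk⟩
    rcases k with _ | k
    · rw [dyadicAt_zero hx] at hb; exact absurd hb hQbad
    · have hc := Q.dyadicAt_succ_isChildOf k x
      -- The parent is not bad. Passing to the child costs 2^n in volume and leaves the factor 4 out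
      -- of 2^(n+2).
      have h1 := not_lt.1 (hk k (Nat.lt_succ_self k))
      rw [vol_eq_two_pow_mul hc] at h1
      have h2 : 2 ^ n * (4 * volume ((Q.dyadicAt (k + 1) x).toSet ∩ E)) ≤
          2 ^ n * (Q.dyadicAt (k + 1) x).vol := by
        refine le_trans ?_ h1
        rw [pow_add, mul_assoc]
        gcongr
        · norm_num
        · exact hc.subset
      exact (ENNReal.mul_le_mul_iff_right (by simp) (by simp)).1 h2
  -- At almost every point of `E` some dyadic cube is more than half filled by `E`, hence bad; the
  -- first bad one is selected.
  · have hd := (ae_restrict_iff' hE).1 (Q.ae_exists_dyadicAt_density E)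
    refine measure_mono_null ?_ (ae_iff.1 hd)
    rintro x ⟨hxE, hxS⟩ hx
    obtain ⟨k, hk⟩ := hx hxE
    have hex : ∃ k, bad (Q.dyadicAt k x) := by
      refine ⟨k, hk.trans_le ?_⟩
      gcongr
      exact le_self_pow₀ (by norm_num) (by omega)
    classical
    refine hxS (mem_iUnion₂.2 ⟨Q.dyadicAt (Nat.find hex) x, ⟨x, hEQ hxE, _, rfl,
      Nat.find_spec hex, fun j hj => Nat.find_min hex hj⟩, mem_dyadicAt _ _ _⟩)

/-- A weak type estimate for the maximal function over triples of dyadic subcubes. -/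
theorem measure_iUnion_large_average_le (Q : Cube n) (f : (Fin n → ℝ) → ℝ≥0∞) {K : ℝ≥0∞}
    (hK : K ≠ 0) :
    K * volume (⋃ P ∈ {P ∈ Q.descendants | K * (∫⁻ x in Q.triple.toSet, f x) * P.triple.vol <
      Q.triple.vol * ∫⁻ x in P.triple.toSet, f x}, P.toSet) ≤ 15 ^ n * Q.vol := by
  set I := ∫⁻ x in Q.triple.toSet, f x with hI
  set t := {P ∈ Q.descendants | K * I * P.triple.vol <
      Q.triple.vol * ∫⁻ x in P.triple.toSet, f x} with ht
  have hsub : ∀ P ∈ t, P.triple.toSet ⊆ Q.triple.toSet := fun P hP =>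
    triple_subset_triple (subset_of_mem_descendants hP.1)
  by_cases hI0 : I = 0
  · have : t = ∅ := by
      refine eq_empty_of_forall_notMem fun P hP => ?_
      have h1 : ∫⁻ x in P.triple.toSet, f x = 0 :=
        le_antisymm ((lintegral_mono_set (hsub P hP)).trans hI0.le) zero_le
      have := hP.2
      simp [h1] at this
    simp [this]
  by_cases hIt : I = ∞
  · have : t = ∅ := by
      refine eq_empty_of_forall_notMem fun P hP => ?_
      have := hP.2
      rw [hIt, ENNReal.mul_top hK, ENNReal.top_mul (vol_ne_zero _)] at this
      exact not_top_lt this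
    simp [this]
  -- A disjoint subfamily of triples suffices after enlargement by 5; together with |3Q| = 3^n |Q|
  -- this gives the constant 15^n.
  obtain ⟨u, hut, hu, hcov⟩ := Vitali.exists_disjoint_subfamily_covering_enlargement_closedBall t
    (fun P => P.triple.center) (fun P => P.triple.half) Q.triple.half (by
      intro P hP
      obtain ⟨k, a, -, rfl⟩ := exists_gridCube_of_mem_descendants hP.1
      simp only [triple, gridCube]
      have := div_le_self Q.half_pos.le (one_le_pow₀ (M₀ := ℝ) one_le_two (n := k))
      linarith) 5 (by norm_num)
  have huc : u.Countable := countable_of_subset_descendants fun P hP => (hut hP).1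
  have hball : ∀ P : Cube n, volume (Metric.closedBall P.triple.center (5 * P.triple.half)) =
      5 ^ n * P.triple.vol := by
    intro P
    have hP := P.triple.half_pos
    rw [Real.volume_pi_closedBall _ (by positivity), Fintype.card_fin, vol_eq,
      show 2 * (5 * P.triple.half) = 5 * (2 * P.triple.half) by ring, mul_pow,
      ENNReal.ofReal_mul (by positivity), ENNReal.ofReal_pow (Nat.ofNat_nonneg 5 : (0 : ℝ) ≤ 5)]
    simp
  have h1 : volume (⋃ P ∈ t, P.toSet) ≤ 5 ^ n * ∑' P : u, (P : Cube n).triple.vol := by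
    rw [← ENNReal.tsum_mul_left]
    calc volume (⋃ P ∈ t, P.toSet)
        ≤ volume (⋃ P ∈ u, Metric.closedBall P.triple.center (5 * P.triple.half)) := by
          refine measure_mono (iUnion₂_subset fun P hP x hx => ?_)
          obtain ⟨b, hb, hPb⟩ := hcov P hP
          exact mem_iUnion₂.2 ⟨b, hb, hPb (toSet_subset_closedBall _ (subset_triple _ hx))⟩
      _ ≤ ∑' P : u, volume (Metric.closedBall (P : Cube n).triple.center
            (5 * (P : Cube n).triple.half)) := measure_biUnion_le _ huc _
      _ = _ := by simp_rw [hball]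
  have h2 : I * (K * ∑' P : u, (P : Cube n).triple.vol) ≤ I * Q.triple.vol := by
    calc I * (K * ∑' P : u, (P : Cube n).triple.vol)
        = ∑' P : u, K * I * (P : Cube n).triple.vol := by
          rw [ENNReal.tsum_mul_left]; ring
      _ ≤ ∑' P : u, Q.triple.vol * ∫⁻ x in (P : Cube n).triple.toSet, f x :=
          ENNReal.tsum_le_tsum fun P => (hut P.2).2.le
      _ = Q.triple.vol * ∫⁻ x in ⋃ P ∈ u, P.triple.toSet, f x := by
          rw [ENNReal.tsum_mul_left, lintegral_biUnion huc
            (fun P _ => P.triple.measurableSet_toSet)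
            (hu.mono fun P => toSet_subset_closedBall _)]
      _ ≤ Q.triple.vol * I := by
          gcongr
          exact lintegral_mono_set (iUnion₂_subset fun P hP => hsub P (hut hP))
      _ = _ := mul_comm _ _
  rw [ENNReal.mul_le_mul_iff_right hI0 hIt, vol_triple] at h2
  calc K * volume (⋃ P ∈ t, P.toSet) ≤ K * (5 ^ n * ∑' P : u, (P : Cube n).triple.vol) := by
        gcongr
    _ = 5 ^ n * (K * ∑' P : u, (P : Cube n).triple.vol) := by ring
    _ ≤ 5 ^ n * (3 ^ n * Q.vol) := by gcongr
    _ = 15 ^ n * Q.vol := by rw [← mul_assoc, ← mul_pow]; norm_num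

end Cube

end SparseDom

/-! ### Averages, oscillations and interpolation -/

namespace SparseDom

variable {n : ℕ}

/-- The uniform probability measure on a cube. -/
noncomputable def Cube.unif (Q : Cube n) : Measure (Fin n → ℝ) :=
  Q.vol⁻¹ • volume.restrict Q.toSet

instance (Q : Cube n) : IsProbabilityMeasure Q.unif := by
  refine ⟨?_⟩
  rw [Cube.unif, Measure.smul_apply, Measure.restrict_apply_univ, smul_eq_mul]
  exact ENNReal.inv_mul_cancel Q.vol_ne_zero Q.vol_ne_top

theorem Cube.unif_absolutelyContinuous (Q : Cube n) : Q.unif ≪ volume :=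
  (Measure.smul_absolutelyContinuous).trans Measure.restrict_le_self.absolutelyContinuous

theorem Cube.vol_mul_lintegral_unif (Q : Cube n) (f : (Fin n → ℝ) → ℝ≥0∞) :
    Q.vol * ∫⁻ x, f x ∂Q.unif = ∫⁻ x in Q.toSet, f x := by
  rw [Cube.unif, lintegral_smul_measure, smul_eq_mul, ← mul_assoc,
    ENNReal.mul_inv_cancel Q.vol_ne_zero Q.vol_ne_top, one_mul]

theorem Cube.vol_mul_unif_apply (Q : Cube n) {s : Set (Fin n → ℝ)} (hs : MeasurableSet s) :
    Q.vol * Q.unif s = volume (s ∩ Q.toSet) := by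
  rw [Cube.unif, Measure.smul_apply, Measure.restrict_apply hs, smul_eq_mul, ← mul_assoc,
    ENNReal.mul_inv_cancel Q.vol_ne_zero Q.vol_ne_top, one_mul]

section Averages

variable {F G : Type*} [NormedAddCommGroup F] [NormedAddCommGroup G]

theorem avgNorm_eq_eLpNorm_unif (r : ℝ≥0∞) (Q : Cube n) (f : (Fin n → ℝ) → F) :
    avgNorm r Q f = eLpNorm f r Q.unif := rfl

theorem avgNorm_eq {r : ℝ≥0∞} (h0 : r ≠ 0) (ht : r ≠ ∞) (Q : Cube n) (f : (Fin n → ℝ) → F) :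
    avgNorm r Q f =
      (Q.vol⁻¹ * ∫⁻ x in Q.toSet, ‖f x‖ₑ ^ r.toReal) ^ (1 / r.toReal) := by
  rw [avgNorm, eLpNorm_eq_lintegral_rpow_enorm_toReal h0 ht, lintegral_smul_measure, smul_eq_mul]

/-- A weak type estimate for the maximal function of `L^p` averages over triples of dyadic
subcubes. -/
theorem measure_iUnion_large_avgNorm_le {p : ℝ≥0∞} (hp : 1 ≤ p) (hpt : p ≠ ∞) (Q : Cube n)
    (f : (Fin n → ℝ) → F) {K : ℝ≥0∞} (hK : 1 ≤ K) :
    K * volume (⋃ P ∈ {P ∈ Q.descendants | K * avgNorm p Q.triple f < avgNorm p P.triple f},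
      P.toSet) ≤ 15 ^ n * Q.vol := by
  refine le_trans ?_ (Q.measure_iUnion_large_average_le (fun x => ‖f x‖ₑ ^ p.toReal)
    (zero_lt_one.trans_le hK).ne')
  gcongr
  rename_i P
  refine iUnion_mono' fun hP => ⟨⟨hP.1, ?_⟩, Subset.rfl⟩
  have hp0 : p ≠ 0 := (zero_lt_one.trans_le hp).ne'
  have hp1 : 1 ≤ p.toReal := by
    rw [← ENNReal.toReal_one]; exact ENNReal.toReal_mono hpt hp
  have hpp : 0 < p.toReal := zero_lt_one.trans_le hp1
  have h := hP.2
  rw [avgNorm_eq hp0 hpt, avgNorm_eq hp0 hpt] at h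
  set I := ∫⁻ x in Q.triple.toSet, ‖f x‖ₑ ^ p.toReal
  set J := ∫⁻ x in P.triple.toSet, ‖f x‖ₑ ^ p.toReal
  have h1 := ENNReal.rpow_lt_rpow h hpp
  rw [ENNReal.mul_rpow_of_nonneg _ _ hpp.le, ← ENNReal.rpow_mul, ← ENNReal.rpow_mul,
    one_div_mul_cancel hpp.ne', ENNReal.rpow_one, ENNReal.rpow_one] at h1
  -- Raising the inequality of averages to the power p turns K into K^p. Because K ≥ 1 this may be
  -- lowered to K again, which keeps the constant independent of p.
  have h2 : K ≤ K ^ p.toReal := by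
    simpa using ENNReal.rpow_le_rpow_of_exponent_le hK hp1
  have h3 : K * (Q.triple.vol⁻¹ * I) < P.triple.vol⁻¹ * J :=
    lt_of_le_of_lt (by gcongr) h1
  have hQ0 := Q.triple.vol_ne_zero
  have hQt := Q.triple.vol_ne_top
  have hP0 := P.triple.vol_ne_zero
  have hPt := P.triple.vol_ne_top
  have h4 : (Q.triple.vol * P.triple.vol) * (K * (Q.triple.vol⁻¹ * I)) <
      (Q.triple.vol * P.triple.vol) * (P.triple.vol⁻¹ * J) :=
    (ENNReal.mul_lt_mul_iff_right (mul_ne_zero hQ0 hP0) (ENNReal.mul_ne_top hQt hPt)).2 h3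
  calc K * I * P.triple.vol
      = (Q.triple.vol * Q.triple.vol⁻¹) * (K * I * P.triple.vol) := by
        rw [ENNReal.mul_inv_cancel hQ0 hQt, one_mul]
    _ = (Q.triple.vol * P.triple.vol) * (K * (Q.triple.vol⁻¹ * I)) := by ring
    _ < _ := h4
    _ = (P.triple.vol * P.triple.vol⁻¹) * (Q.triple.vol * J) := by ring
    _ = Q.triple.vol * J := by rw [ENNReal.mul_inv_cancel hP0 hPt, one_mul]

theorem lintegral_enorm_mul_enorm_le {α : Type*} [MeasurableSpace α] {μ : Measure α}
    {p q : ℝ≥0∞} [ENNReal.HolderTriple p q 1] {u : α → F} {v : α → G}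
    (hu : AEStronglyMeasurable u μ) (hv : AEStronglyMeasurable v μ) :
    ∫⁻ x, ‖u x‖ₑ * ‖v x‖ₑ ∂μ ≤ eLpNorm u p μ * eLpNorm v q μ := by
  have h := eLpNorm_le_eLpNorm_mul_eLpNorm_of_nnnorm (p := p) (q := q) (r := 1) hu.norm hv.norm
    (fun a b => a * b) 1 (Filter.Eventually.of_forall fun x => by simp)
  rw [eLpNorm_norm, eLpNorm_norm, eLpNorm_one_eq_lintegral_enorm] at h
  simpa [enorm_mul] using h

theorem osc_eq (s : ℝ≥0∞) (h : (Fin n → ℝ) → F) (Q : Cube n) :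
    osc s h Q = eLpNorm (fun z : (Fin n → ℝ) × (Fin n → ℝ) => h z.1 - h z.2) s
      (Q.unif.prod Q.unif) := by
  have : Q.unif.prod Q.unif = (Q.vol ^ 2)⁻¹ •
      (volume : Measure ((Fin n → ℝ) × (Fin n → ℝ))).restrict (Q.toSet ×ˢ Q.toSet) := by
    rw [Cube.unif, Measure.prod_smul_left, Measure.prod_smul_right, Measure.prod_restrict,
      smul_smul, ← Measure.volume_eq_prod, pow_two,
      ENNReal.mul_inv (Or.inl Q.vol_ne_zero) (Or.inl Q.vol_ne_top)]
  rw [osc, this]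

/-- If `h` is bounded by `B` on at least half of the cube `P`, then its integral against a weight
is controlled by its oscillation and `B`. -/
theorem setLIntegral_enorm_mul_le_osc {q q' : ℝ≥0∞} [ENNReal.HolderConjugate q q']
    (P : Cube n) {h : (Fin n → ℝ) → F} {w : (Fin n → ℝ) → G}
    (hh : AEStronglyMeasurable h volume) (hw : AEStronglyMeasurable w volume)
    {N : Set (Fin n → ℝ)} (hN : 2 * volume N ≤ P.vol) {B : ℝ≥0∞}
    (hB : ∀ x ∈ P.toSet \ N, ‖h x‖ₑ ≤ B) :
    ∫⁻ x in P.toSet, ‖h x‖ₑ * ‖w x‖ₑ ≤ (2 * osc q h P + B) * (P.vol * avgNorm q' P w) := by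
  have hh' := hh.mono_ac P.unif_absolutelyContinuous
  have hw' := hw.mono_ac P.unif_absolutelyContinuous
  have hq' : 1 ≤ q' := ENNReal.HolderConjugate.one_le q' q
  set D : (Fin n → ℝ) × (Fin n → ℝ) → ℝ≥0∞ := fun z => ‖h z.2 - h z.1‖ₑ * ‖w z.2‖ₑ with hD
  have hdm : AEStronglyMeasurable (fun z : (Fin n → ℝ) × (Fin n → ℝ) => h z.2 - h z.1)
      (P.unif.prod P.unif) := hh'.comp_snd.sub hh'.comp_fst
  have hDm : AEMeasurable D (P.unif.prod P.unif) := hdm.enorm.mul hw'.comp_snd.enorm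
  have hDI : ∫⁻ y, ∫⁻ x, D (y, x) ∂P.unif ∂P.unif ≤ osc q h P * avgNorm q' P w := by
    rw [← lintegral_prod _ hDm, osc_eq, avgNorm_eq_eLpNorm_unif]
    refine (lintegral_enorm_mul_enorm_le (p := q) (q := q') hdm hw'.comp_snd).trans
      (le_of_eq ?_)
    congr 1
    · rw [← eLpNorm_neg]
      congr 1
      ext z
      simp
    · exact eLpNorm_comp_measurePreserving (g := w) hw' measurePreserving_snd
  -- `N` need not be measurable; a measurable hull has the same measure, so A still fills at least
  -- half of `P`.
  let A : Set (Fin n → ℝ) := P.toSet \ toMeasurable volume N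
  have hAm : MeasurableSet A := P.measurableSet_toSet.diff (measurableSet_toMeasurable _ _)
  have hA : 2⁻¹ ≤ P.unif A := by
    have h1 : P.vol ≤ P.vol * P.unif A + volume N := by
      rw [P.vol_mul_unif_apply hAm, inter_eq_left.2 sdiff_subset]
      calc P.vol = volume P.toSet := rfl
        _ ≤ volume (A ∪ toMeasurable volume N) :=
            measure_mono (by rw [sdiff_union_self]; exact subset_union_left)
        _ ≤ volume A + volume (toMeasurable volume N) := measure_union_le _ _
        _ = _ := by rw [measure_toMeasurable]
    by_contra hlt
    rw [not_le] at hlt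
    have h2 : P.vol * P.unif A < P.vol * 2⁻¹ :=
      (ENNReal.mul_lt_mul_iff_right P.vol_ne_zero P.vol_ne_top).2 hlt
    have h3 : volume N ≤ P.vol * 2⁻¹ := by
      rw [← div_eq_mul_inv, ENNReal.le_div_iff_mul_le (by simp) (by simp), mul_comm]
      exact hN
    have h4 : P.vol < P.vol * 2⁻¹ + P.vol * 2⁻¹ :=
      h1.trans_lt (ENNReal.add_lt_add_of_lt_of_le (ne_top_of_le_ne_top (ENNReal.mul_ne_top P.vol_ne_top (by simp)) h3) h2 h3)
    rw [← mul_add, ENNReal.inv_two_add_inv_two, mul_one] at h4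
    exact lt_irrefl _ h4
  have hA0 : P.unif A ≠ 0 := fun h => by simp [h] at hA
  -- A reference point y is chosen in A whose weighted oscillation is at most the mean over A, hence
  -- at most twice the mean over `P`. Being in A, it also satisfies ‖h y‖ ≤ B, and h is compared
  -- with h y.
  obtain ⟨y, hyA, hy⟩ := exists_le_setLAverage (f := fun y => ∫⁻ x, D (y, x) ∂P.unif) hA0
    (measure_ne_top _ _) (hDm.lintegral_prod_right'.restrict)
  have hy' : ∫⁻ x, D (y, x) ∂P.unif ≤ 2 * (osc q h P * avgNorm q' P w) := by
    refine hy.trans ?_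
    rw [setLAverage_eq]
    calc (∫⁻ y in A, ∫⁻ x, D (y, x) ∂P.unif ∂P.unif) / P.unif A
        ≤ (∫⁻ y, ∫⁻ x, D (y, x) ∂P.unif ∂P.unif) / 2⁻¹ :=
          ENNReal.div_le_div (setLIntegral_le_lintegral _ _) hA
      _ ≤ (osc q h P * avgNorm q' P w) / 2⁻¹ := by gcongr
      _ = _ := by rw [div_eq_mul_inv, inv_inv, mul_comm]
  have hyB : ‖h y‖ₑ ≤ B :=
    hB y ⟨hyA.1, fun hyN => hyA.2 (subset_toMeasurable _ _ hyN)⟩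
  have hw1 : ∫⁻ x, ‖w x‖ₑ ∂P.unif ≤ avgNorm q' P w := by
    rw [← eLpNorm_one_eq_lintegral_enorm, avgNorm_eq_eLpNorm_unif]
    exact eLpNorm_le_eLpNorm_of_exponent_le hq' hw'
  rw [← P.vol_mul_lintegral_unif, mul_left_comm]
  gcongr
  calc ∫⁻ x, ‖h x‖ₑ * ‖w x‖ₑ ∂P.unif ≤ ∫⁻ x, (D (y, x) + B * ‖w x‖ₑ) ∂P.unif := by
        refine lintegral_mono fun x => ?_
        simp only [hD, ← add_mul]
        gcongr
        calc ‖h x‖ₑ = ‖(h x - h y) + h y‖ₑ := by rw [sub_add_cancel]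
          _ ≤ ‖h x - h y‖ₑ + ‖h y‖ₑ := enorm_add_le _ _
          _ ≤ _ := by gcongr
    _ = ∫⁻ x, D (y, x) ∂P.unif + B * ∫⁻ x, ‖w x‖ₑ ∂P.unif := by
        rw [lintegral_add_right' _ (hw'.enorm.const_mul _), lintegral_const_mul'' _ hw'.enorm]
    _ ≤ 2 * (osc q h P * avgNorm q' P w) + B * avgNorm q' P w := by gcongr
    _ = _ := by ring

theorem setLIntegral_enorm_le_avgNorm {r : ℝ≥0∞} (hr : 1 ≤ r) (Q : Cube n)
    {w : (Fin n → ℝ) → G} (hw : AEStronglyMeasurable w volume) :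
    ∫⁻ x in Q.toSet, ‖w x‖ₑ ≤ Q.vol * avgNorm r Q w := by
  rw [← Q.vol_mul_lintegral_unif, ← eLpNorm_one_eq_lintegral_enorm, avgNorm_eq_eLpNorm_unif]
  gcongr
  exact eLpNorm_le_eLpNorm_of_exponent_le hr (hw.mono_ac Q.unif_absolutelyContinuous)

theorem vol_mul_avgNorm_eq {r : ℝ≥0∞} (h0 : r ≠ 0) (ht : r ≠ ∞) (Q : Cube n)
    (w : (Fin n → ℝ) → G) :
    Q.vol * avgNorm r Q w = Q.vol ^ (1 - 1 / r.toReal) *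
      (∫⁻ x in Q.toSet, ‖w x‖ₑ ^ r.toReal) ^ (1 / r.toReal) := by
  have hr : 0 < r.toReal := ENNReal.toReal_pos h0 ht
  rw [avgNorm_eq h0 ht, ENNReal.mul_rpow_of_nonneg _ _ (by positivity), ← mul_assoc,
    ENNReal.rpow_sub _ _ Q.vol_ne_zero Q.vol_ne_top, ENNReal.rpow_one, ENNReal.inv_rpow,
    ← div_eq_mul_inv]

/-- Jensen's inequality for averages over disjoint subcubes. -/
theorem tsum_vol_mul_avgNorm_le {r : ℝ≥0∞} (hr : 1 ≤ r) (ht : r ≠ ∞) {S : Set (Cube n)}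
    (hS : S.Countable) (hdisj : S.PairwiseDisjoint Cube.toSet) (Q : Cube n)
    (hSQ : ∀ P ∈ S, P.toSet ⊆ Q.toSet) (w : (Fin n → ℝ) → G) :
    ∑' P : S, (P : Cube n).vol * avgNorm r P w ≤ Q.vol * avgNorm r Q w := by
  have h0 : r ≠ 0 := (zero_lt_one.trans_le hr).ne'
  have hr1 : 1 ≤ r.toReal := by
    rw [← ENNReal.toReal_one]; exact ENNReal.toReal_mono ht hr
  have hr0 : 0 < r.toReal := zero_lt_one.trans_le hr1
  have hr2 : 1 / r.toReal ≤ 1 := (div_le_one hr0).2 hr1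
  let _ : MeasurableSpace S := ⊤
  have : MeasurableSingletonClass S := ⟨fun _ => MeasurableSpace.measurableSet_top⟩
  have hm : ∀ f : S → ℝ≥0∞, AEMeasurable f Measure.count := fun f =>
    (measurable_from_top).aemeasurable
  -- Each summand equals |P|^(1-1/r) (∫_P |w|^r)^(1/r), so Hölder's inequality for counting measure
  -- with these exponents sums the family.
  have h := ENNReal.lintegral_mul_norm_pow_le (μ := (Measure.count : Measure S))
    (hm fun P => (P : Cube n).vol)
    (hm fun P => ∫⁻ x in (P : Cube n).toSet, ‖w x‖ₑ ^ r.toReal)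
    (p := 1 - 1 / r.toReal) (q := 1 / r.toReal) (by linarith) (by positivity) (by ring)
  rw [lintegral_count, lintegral_count, lintegral_count] at h
  simp_rw [vol_mul_avgNorm_eq h0 ht]
  refine h.trans ?_
  have hsub : ⋃ P ∈ S, P.toSet ⊆ Q.toSet := iUnion₂_subset hSQ
  refine mul_le_mul' (ENNReal.rpow_le_rpow ?_ (by linarith))
    (ENNReal.rpow_le_rpow ?_ (by positivity))
  · simp only [Cube.vol]
    rw [← measure_biUnion hS hdisj fun P _ => P.measurableSet_toSet]
    exact measure_mono hsub
  · rw [← lintegral_biUnion hS (fun P _ => P.measurableSet_toSet) hdisj]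
    exact lintegral_mono_set hsub

theorem vol_mul_avgNorm_mono {r : ℝ≥0∞} (hr : 1 ≤ r) (ht : r ≠ ∞) {P Q : Cube n}
    (h : P.toSet ⊆ Q.toSet) (w : (Fin n → ℝ) → G) :
    P.vol * avgNorm r P w ≤ Q.vol * avgNorm r Q w := by
  have := tsum_vol_mul_avgNorm_le hr ht (countable_singleton P) (pairwiseDisjoint_singleton _ _) Q
    (by simpa using h) w
  rwa [tsum_singleton P fun P => P.vol * avgNorm r P w] at this

/-- Hölder's inequality applied to the factorization |B|^k |f| = (|B|^m |f|)^θ |f|^θ', with mθ = k.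
-/
theorem avgNorm_interpolate {p : ℝ≥0∞} (hp0 : p ≠ 0) (hpt : p ≠ ∞) (Q : Cube n)
    {B : (Fin n → ℝ) → F} {f : (Fin n → ℝ) → G} (hB : AEStronglyMeasurable B volume)
    (hf : AEStronglyMeasurable f volume) {k m : ℕ} {θ θ' : ℝ} (h0 : 0 ≤ θ) (h0' : 0 ≤ θ')
    (h1 : θ + θ' = 1) (hk : (k : ℝ) = m * θ) :
    avgNorm p Q (fun x => ‖B x‖ ^ k * ‖f x‖) ≤
      avgNorm p Q (fun x => ‖B x‖ ^ m * ‖f x‖) ^ θ * avgNorm p Q f ^ θ' := by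
  have hp : 0 < p.toReal := ENNReal.toReal_pos hp0 hpt
  have hB' := hB.mono_ac Q.unif_absolutelyContinuous
  have hf' := hf.mono_ac Q.unif_absolutelyContinuous
  simp only [avgNorm_eq_eLpNorm_unif, eLpNorm_eq_lintegral_rpow_enorm_toReal hp0 hpt,
    enorm_mul, enorm_pow, enorm_norm]
  have e : ∀ x, (‖B x‖ₑ ^ k * ‖f x‖ₑ) ^ p.toReal =
      ((‖B x‖ₑ ^ m * ‖f x‖ₑ) ^ p.toReal) ^ θ * (‖f x‖ₑ ^ p.toReal) ^ θ' := by
    intro x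
    generalize ‖B x‖ₑ = β
    generalize ‖f x‖ₑ = φ
    rw [ENNReal.mul_rpow_of_nonneg _ _ hp.le, ENNReal.mul_rpow_of_nonneg _ _ hp.le,
      ENNReal.mul_rpow_of_nonneg _ _ h0, mul_assoc, ← ENNReal.rpow_add_of_nonneg _ _ h0 h0', h1,
      ENNReal.rpow_one, ← ENNReal.rpow_natCast, ← ENNReal.rpow_natCast, ← ENNReal.rpow_mul,
      ← ENNReal.rpow_mul, ← ENNReal.rpow_mul, hk]
    congr 2
    ring
  simp_rw [e]
  rw [← ENNReal.rpow_mul, ← ENNReal.rpow_mul, mul_comm (1 / p.toReal), mul_comm (1 / p.toReal),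
    ENNReal.rpow_mul, ENNReal.rpow_mul, ← ENNReal.mul_rpow_of_nonneg _ _ (by positivity)]
  gcongr
  exact ENNReal.lintegral_mul_norm_pow_le (((hB'.enorm.pow_const m).mul hf'.enorm).pow_const _)
    (hf'.enorm.pow_const _) h0 h0' h1

/-- Interpolating both factors with complementary exponents gives X^θ Y^θ' for the two extreme
products X and Y, and this is at most X + Y. Hence only the powers 0 and m appear in the sparse
forms. -/
theorem avgNorm_mul_avgNorm_le {p r : ℝ≥0∞} (hp0 : p ≠ 0) (hpt : p ≠ ∞) (hr0 : r ≠ 0)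
    (hrt : r ≠ ∞) (Q : Cube n) {B : (Fin n → ℝ) → F} {f g : (Fin n → ℝ) → G}
    (hB : AEStronglyMeasurable B volume) (hf : AEStronglyMeasurable f volume)
    (hg : AEStronglyMeasurable g volume) {k m : ℕ} (hk : k ≤ m) :
    avgNorm p Q (fun x => ‖B x‖ ^ k * ‖f x‖) * avgNorm r Q (fun x => ‖B x‖ ^ (m - k) * ‖g x‖) ≤
      avgNorm p Q (fun x => ‖B x‖ ^ m * ‖f x‖) * avgNorm r Q g +
        avgNorm p Q f * avgNorm r Q (fun x => ‖B x‖ ^ m * ‖g x‖) := by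
  obtain ⟨θ, θ', h0, h0', h1, hkθ, hkθ'⟩ : ∃ θ θ' : ℝ, 0 ≤ θ ∧ 0 ≤ θ' ∧ θ + θ' = 1 ∧
      (k : ℝ) = m * θ ∧ ((m - k : ℕ) : ℝ) = m * θ' := by
    rcases Nat.eq_zero_or_pos m with rfl | hm
    -- For m = 0 the quotient k/m is meaningless; any convex pair works.
    · obtain rfl : k = 0 := by omega
      exact ⟨1, 0, by norm_num, le_rfl, by norm_num, by simp, by simp⟩
    · have hm' : (0 : ℝ) < m := by exact_mod_cast hm
      have hk' : (k : ℝ) ≤ m := by exact_mod_cast hk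
      refine ⟨k / m, (m - k) / m, by positivity, div_nonneg (by linarith) hm'.le,
        by field_simp; ring, by field_simp, ?_⟩
      rw [Nat.cast_sub hk]; field_simp
  have hF := avgNorm_interpolate hp0 hpt Q hB hf h0 h0' h1 hkθ
  have hG := avgNorm_interpolate hr0 hrt Q hB hg h0' h0 (by linarith) hkθ'
  refine (mul_le_mul' hF hG).trans ?_
  generalize avgNorm p Q (fun x => ‖B x‖ ^ m * ‖f x‖) = a
  generalize avgNorm r Q (fun x => ‖B x‖ ^ m * ‖g x‖) = b
  generalize avgNorm p Q f = c
  generalize avgNorm r Q g = d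
  calc a ^ θ * c ^ θ' * (b ^ θ' * d ^ θ) = (a * d) ^ θ * (c * b) ^ θ' := by
        rw [ENNReal.mul_rpow_of_nonneg _ _ h0, ENNReal.mul_rpow_of_nonneg _ _ h0']; ring
    _ ≤ (a * d + c * b) ^ θ * (a * d + c * b) ^ θ' := by
        gcongr
        · exact le_self_add
        · exact le_add_self
    _ = _ := by rw [← ENNReal.rpow_add_of_nonneg _ _ h0 h0', h1, ENNReal.rpow_one]

end Averages

end SparseDom

/-! ### Sublinear operators and the expansion of commutators -/

namespace SparseDom

variable {n : ℕ} {𝕜 : Type*} [RCLike 𝕜]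

theorem BddSuppLp.add {p : ℝ≥0∞} {f g : (Fin n → ℝ) → 𝕜} (hf : BddSuppLp p f)
    (hg : BddSuppLp p g) : BddSuppLp p (f + g) :=
  ⟨hf.1.add hg.1, (hf.2.union hg.2).subset (Function.support_add f g)⟩

theorem BddSuppLp.const_smul {p : ℝ≥0∞} {f : (Fin n → ℝ) → 𝕜} (hf : BddSuppLp p f) (c : 𝕜) :
    BddSuppLp p (c • f) :=
  ⟨hf.1.const_smul c, hf.2.subset (Function.support_const_smul_subset c f)⟩

theorem BddSuppLp.indicator {p : ℝ≥0∞} {f : (Fin n → ℝ) → 𝕜} (hf : BddSuppLp p f)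
    {s : Set (Fin n → ℝ)} (hs : MeasurableSet s) : BddSuppLp p (s.indicator f) :=
  ⟨hf.1.indicator hs, hf.2.subset (by rw [Set.support_indicator]; exact inter_subset_right)⟩

/-- The space of boundedly supported `L^p` functions. -/
def bddSuppLpSubmodule (n : ℕ) (𝕜 : Type*) [RCLike 𝕜] (p : ℝ≥0∞) :
    Submodule 𝕜 ((Fin n → ℝ) → 𝕜) where
  carrier := {f | BddSuppLp p f}
  add_mem' := BddSuppLp.add
  zero_mem' := ⟨MemLp.zero, by simp⟩
  smul_mem' c _ hf := hf.const_smul c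

namespace IsSublinear

variable {p : ℝ≥0∞} {T : ((Fin n → ℝ) → 𝕜) → (Fin n → ℝ) → 𝕜}

theorem ae_of_finite (hT : IsSublinear p T) {s : Set ((Fin n → ℝ) → 𝕜)} (hs : s.Finite)
    (h : ∀ v ∈ s, BddSuppLp p v) :
    ∀ᵐ x, (∀ u ∈ Submodule.span 𝕜 s, ∀ v ∈ Submodule.span 𝕜 s,
      ‖T (u + v) x‖ ≤ ‖T u x‖ + ‖T v x‖) ∧
      ∀ c : 𝕜, ∀ u ∈ Submodule.span 𝕜 s, ‖T (c • u) x‖ = ‖c‖ * ‖T u x‖ :=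
  hT.sublinear _ (Submodule.fg_span hs) fun _ hu =>
    (Submodule.span_le (p := bddSuppLpSubmodule n 𝕜 p)).2 h hu

/-- The null set precedes the coefficients: in the commutator they depend on b(x), so one null set
must serve all of them. The finite-dimensional span of the v i provides it. -/
theorem ae_norm_sum_smul_le (hT : IsSublinear p T) {ι : Type*} (s : Finset ι)
    (v : ι → (Fin n → ℝ) → 𝕜) (hv : ∀ i ∈ s, BddSuppLp p (v i)) :
    ∀ᵐ x, ∀ a : ι → 𝕜, ‖T (∑ i ∈ s, a i • v i) x‖ ≤ ∑ i ∈ s, ‖a i‖ * ‖T (v i) x‖ := by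
  classical
  have hfin : (v '' (s : Set ι)).Finite := s.finite_toSet.image v
  filter_upwards [hT.ae_of_finite hfin (by rintro _ ⟨i, hi, rfl⟩; exact hv i hi)] with x hx a
  have hmem : ∀ i ∈ s, v i ∈ Submodule.span 𝕜 (v '' (s : Set ι)) := fun i hi =>
    Submodule.subset_span ⟨i, hi, rfl⟩
  have key : ∀ t ⊆ s, ‖T (∑ i ∈ t, a i • v i) x‖ ≤ ∑ i ∈ t, ‖a i‖ * ‖T (v i) x‖ := by
    intro t
    induction t using Finset.induction_on with
    | empty =>
      intro _
      -- Homogeneity with the scalar 0 gives T 0 = 0 at x.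
      have := hx.2 0 0 (Submodule.zero_mem _)
      simp only [smul_zero, norm_zero, zero_mul] at this
      simp [this]
    | insert i t hi ih =>
      intro ht
      have hi' : i ∈ s := ht (Finset.mem_insert_self _ _)
      have ht' : t ⊆ s := fun j hj => ht (Finset.mem_insert_of_mem hj)
      rw [Finset.sum_insert hi, Finset.sum_insert hi, ← hx.2 _ _ (hmem i hi')]
      refine (hx.1 _ (Submodule.smul_mem _ _ (hmem i hi')) _
        (Submodule.sum_mem _ fun j hj => Submodule.smul_mem _ _ (hmem j (ht' hj)))).trans ?_
      gcongr
      exact ih ht'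
  exact key s Finset.Subset.rfl

theorem ae_norm_sum_smul_add_le (hT : IsSublinear p T) {ι : Type*} (s : Finset ι)
    (v w : ι → (Fin n → ℝ) → 𝕜) (hv : ∀ i ∈ s, BddSuppLp p (v i))
    (hw : ∀ i ∈ s, BddSuppLp p (w i)) :
    ∀ᵐ x, ∀ a : ι → 𝕜, ‖T (∑ i ∈ s, a i • (v i + w i)) x‖ ≤
      ‖T (∑ i ∈ s, a i • v i) x‖ + ‖T (∑ i ∈ s, a i • w i) x‖ := by
  have hfin : (v '' (s : Set ι) ∪ w '' (s : Set ι)).Finite :=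
    (s.finite_toSet.image v).union (s.finite_toSet.image w)
  filter_upwards [hT.ae_of_finite hfin (by
    rintro _ (⟨i, hi, rfl⟩ | ⟨i, hi, rfl⟩)
    exacts [hv i hi, hw i hi])] with x hx a
  simp_rw [smul_add, Finset.sum_add_distrib]
  exact hx.1 _ (Submodule.sum_mem _ fun j hj => Submodule.smul_mem _ _
    (Submodule.subset_span (Or.inl ⟨j, hj, rfl⟩))) _ (Submodule.sum_mem _ fun j hj =>
    Submodule.smul_mem _ _ (Submodule.subset_span (Or.inr ⟨j, hj, rfl⟩)))

theorem ae_norm_le_add (hT : IsSublinear p T) {u v : (Fin n → ℝ) → 𝕜} (hu : BddSuppLp p u)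
    (hv : BddSuppLp p v) : ∀ᵐ x, ‖T u x‖ ≤ ‖T (u + v) x‖ + ‖T v x‖ := by
  filter_upwards [hT.ae_of_finite (s := {u, v}) (Set.toFinite _) (by
    rintro _ (rfl | rfl)
    exacts [hu, hv])] with x hx
  have hu' : u ∈ Submodule.span 𝕜 {u, v} := Submodule.subset_span (Or.inl rfl)
  have hv' : v ∈ Submodule.span 𝕜 {u, v} := Submodule.subset_span (Or.inr rfl)
  have h1 := hx.1 (u + v) (Submodule.add_mem _ hu' hv') ((-1 : 𝕜) • v)
    (Submodule.smul_mem _ _ hv')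
  rw [hx.2 _ _ hv'] at h1
  simpa using h1

end IsSublinear

section Commutator

variable {p : ℝ≥0∞} {T : ((Fin n → ℝ) → 𝕜) → (Fin n → ℝ) → 𝕜} {b : (Fin n → ℝ) → 𝕜} {m : ℕ}

/-- As t = b(x) varies, the argument of `T` in the commutator stays in the span of the m + 1 fixed
functions (b - c)^k f. -/
theorem sub_pow_mul_eq_sum (b : (Fin n → ℝ) → 𝕜) (m : ℕ) (f : (Fin n → ℝ) → 𝕜) (c t : 𝕜) :
    (fun y => (t - b y) ^ m * f y) = ∑ k ∈ Finset.range (m + 1),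
      ((-1) ^ k * (t - c) ^ (m - k) * (m.choose k : 𝕜)) • fun y => (b y - c) ^ k * f y := by
  ext y
  rw [Finset.sum_apply, show t - b y = -(b y - c) + (t - c) by ring, add_pow, Finset.sum_mul]
  refine Finset.sum_congr rfl fun k _ => ?_
  rw [neg_pow]
  simp only [Pi.smul_apply, smul_eq_mul]
  ring

/-- Expansion of the iterated commutator in powers of `b - c`. -/
theorem ae_enorm_commutator_le (hT : IsSublinear p T) {f : (Fin n → ℝ) → 𝕜} (c : 𝕜)
    (hf : ∀ k ≤ m, BddSuppLp p fun y => (b y - c) ^ k * f y) :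
    ∀ᵐ x, ‖commutator T b m f x‖ₑ ≤ ∑ k ∈ Finset.range (m + 1),
      (m.choose k : ℝ≥0∞) * ‖b x - c‖ₑ ^ (m - k) *
        ‖T (fun y => (b y - c) ^ k * f y) x‖ₑ := by
  filter_upwards [hT.ae_norm_sum_smul_le (Finset.range (m + 1))
    (fun k y => (b y - c) ^ k * f y) fun k hk => hf k (by simpa [Nat.lt_succ_iff] using hk)]
    with x hx
  rw [commutator, sub_pow_mul_eq_sum b m f c (b x)]
  have h := hx fun k => (-1) ^ k * (b x - c) ^ (m - k) * (m.choose k : 𝕜)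
  rw [← ofReal_norm]
  refine (ENNReal.ofReal_le_ofReal h).trans (le_of_eq ?_)
  rw [ENNReal.ofReal_sum_of_nonneg fun k _ => by positivity]
  refine Finset.sum_congr rfl fun k _ => ?_
  rw [ENNReal.ofReal_mul (by positivity), ofReal_norm, ofReal_norm, enorm_mul, enorm_mul,
    enorm_pow, enorm_pow]
  have h1 : ‖(m.choose k : 𝕜)‖ₑ = (m.choose k : ℝ≥0∞) := by
    rw [← ofReal_norm, RCLike.norm_natCast, ENNReal.ofReal_natCast]
  rw [h1, enorm_neg, enorm_one, one_pow, one_mul, mul_comm (‖b x - c‖ₑ ^ (m - k))]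

theorem ae_enorm_commutator_add_le (hT : IsSublinear p T) {f g : (Fin n → ℝ) → 𝕜} (c : 𝕜)
    (hf : ∀ k ≤ m, BddSuppLp p fun y => (b y - c) ^ k * f y)
    (hg : ∀ k ≤ m, BddSuppLp p fun y => (b y - c) ^ k * g y) :
    ∀ᵐ x, ‖commutator T b m (f + g) x‖ₑ ≤
      ‖commutator T b m f x‖ₑ + ‖commutator T b m g x‖ₑ := by
  filter_upwards [hT.ae_norm_sum_smul_add_le (Finset.range (m + 1))
    (fun k y => (b y - c) ^ k * f y) (fun k y => (b y - c) ^ k * g y)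
    (fun k hk => hf k (by simpa [Nat.lt_succ_iff] using hk))
    (fun k hk => hg k (by simpa [Nat.lt_succ_iff] using hk))] with x hx
  have h := hx fun k => (-1) ^ k * (b x - c) ^ (m - k) * (m.choose k : 𝕜)
  have e : ∀ k : ℕ, ((fun y => (b y - c) ^ k * f y) + fun y => (b y - c) ^ k * g y) =
      fun y => (b y - c) ^ k * (f + g) y := fun k => by
    ext y; simp [mul_add]
  simp_rw [e] at h
  rw [← sub_pow_mul_eq_sum, ← sub_pow_mul_eq_sum, ← sub_pow_mul_eq_sum] at h
  rw [commutator, commutator, commutator, ← ofReal_norm, ← ofReal_norm, ← ofReal_norm,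
    ← ENNReal.ofReal_add (norm_nonneg _) (norm_nonneg _)]
  exact ENNReal.ofReal_le_ofReal h

/-- Since k ≤ m, the function is dominated by a multiple of |f| + |b^m f|; integrability of the top
power suffices for all lower powers and all centres c. -/
theorem bddSuppLp_sub_pow_mul {f : (Fin n → ℝ) → 𝕜} (hb : AEStronglyMeasurable b volume)
    (hfp : MemLp f p volume) (hfs : HasCompactSupport f)
    (hbf : MemLp (fun x => b x ^ m * f x) p volume) (c : 𝕜) {k : ℕ} (hk : k ≤ m) :
    BddSuppLp p fun y => (b y - c) ^ k * f y := by
  refine ⟨?_, (hfs.isCompact.isBounded.subset (subset_tsupport f)).subset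
    (Function.support_mul_subset_right _ _)⟩
  have hdom : MemLp (fun x => 2 ^ m * ((1 + ‖c‖) ^ m * ‖f x‖ + ‖b x ^ m * f x‖)) p volume :=
    ((hfp.norm.const_mul _).add hbf.norm).const_mul _
  refine hdom.mono (((hb.sub aestronglyMeasurable_const).pow k).mul hfp.1)
    (Filter.Eventually.of_forall fun x => ?_)
  rw [norm_mul, norm_pow, Real.norm_of_nonneg (by positivity), norm_mul, norm_pow, ← add_mul,
    ← mul_assoc]
  gcongr
  have h1 : ‖b x - c‖ ≤ (1 + ‖c‖) + ‖b x‖ := by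
    have := norm_sub_le (b x) c; linarith
  have h2 : (1 : ℝ) ≤ (1 + ‖c‖) + ‖b x‖ := by
    have := norm_nonneg c; have := norm_nonneg (b x); linarith
  calc ‖b x - c‖ ^ k ≤ ((1 + ‖c‖) + ‖b x‖) ^ k := by gcongr
    _ ≤ ((1 + ‖c‖) + ‖b x‖) ^ m := pow_le_pow_right₀ h2 hk
    _ ≤ 2 ^ (m - 1) * ((1 + ‖c‖) ^ m + ‖b x‖ ^ m) :=
        add_pow_le (by positivity) (norm_nonneg _) m
    _ ≤ 2 ^ m * ((1 + ‖c‖) ^ m + ‖b x‖ ^ m) := by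
        gcongr
        · norm_num
        · omega

end Commutator

end SparseDom

/-! ### The exceptional set and the far part on a stopping cube -/

namespace SparseDom

variable {n : ℕ} {𝕜 : Type*} [RCLike 𝕜]

/-- The level at which the weak type hypotheses are used. -/
noncomputable def weakLevel (n m : ℕ) : ℝ := (2 ^ (n + 5) * 3 ^ n * (m + 1))⁻¹

theorem weakLevel_pos (n m : ℕ) : 0 < weakLevel n m := by
  rw [weakLevel]; positivity

theorem weakLevel_lt_one (n m : ℕ) : weakLevel n m < 1 := by
  refine inv_lt_one_of_one_lt₀ ?_
  have h1 : (1 : ℝ) ≤ 3 ^ n := one_le_pow₀ (by norm_num)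
  have h2 : (1 : ℝ) ≤ m + 1 := by linarith [(Nat.cast_nonneg m : (0 : ℝ) ≤ m)]
  have h3 : (1 : ℝ) < 2 ^ (n + 5) := one_lt_pow₀ (by norm_num) (by omega)
  exact one_lt_mul_of_lt_of_le (one_lt_mul_of_lt_of_le h3 h1) h2

theorem weakLevel_mul (n m : ℕ) :
    (2 ^ (n + 5) * 3 ^ n * (m + 1)) * ENNReal.ofReal (weakLevel n m) = 1 := by
  have e : (2 ^ (n + 5) * 3 ^ n * (m + 1) : ℝ≥0∞) =
      ENNReal.ofReal (2 ^ (n + 5) * 3 ^ n * (m + 1)) := by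
    have h : (m + 1 : ℝ) = ((m + 1 : ℕ) : ℝ) := by push_cast; rfl
    have h2 : (m + 1 : ℝ≥0∞) = ((m + 1 : ℕ) : ℝ≥0∞) := by push_cast; rfl
    rw [h, h2, ENNReal.ofReal_mul (by positivity), ENNReal.ofReal_mul (by positivity),
      ENNReal.ofReal_pow (zero_le_two), ENNReal.ofReal_pow (zero_le_three), ENNReal.ofReal_natCast]
    simp
  rw [e, weakLevel, ← ENNReal.ofReal_mul (by positivity), mul_inv_cancel₀ (by positivity),
    ENNReal.ofReal_one]

/-- The admitted growth of averages over triples in the stopping time argument. -/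
def avgGrowth (n m : ℕ) : ℕ := 2 ^ (n + 4) * 15 ^ n * (m + 1)

section Step

variable {p q q' : ℝ≥0∞} {α : ℝ} {φT φM : ℝ → ℝ≥0}
  {T : ((Fin n → ℝ) → 𝕜) → (Fin n → ℝ) → 𝕜}

/-- The common factor of the bounds for `T` and the maximal operator on `3Q`. -/
noncomputable def localBound (p : ℝ≥0∞) (α : ℝ) (Q : Cube n) (F : (Fin n → ℝ) → 𝕜) : ℝ≥0∞ :=
  avgNorm p Q.triple F * Q.triple.vol ^ (α / n)

/-- The properties of a set in `Q` off which `T`, its maximal operator and the averages of `F` are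
under control. -/
structure IsExceptional (p q : ℝ≥0∞) (α : ℝ) (A B K : ℝ≥0∞)
    (T : ((Fin n → ℝ) → 𝕜) → (Fin n → ℝ) → 𝕜) (F : (Fin n → ℝ) → 𝕜) (Q : Cube n)
    (E : Set (Fin n → ℝ)) : Prop where
  operator_le : ∀ x ∈ Q.toSet \ E,
    ‖T (Q.triple.toSet.indicator F) x‖ₑ ≤ A * localBound p α Q F
  maximal_le : ∀ x ∈ Q.toSet \ E,
    sharpMaximal T q (Q.triple.toSet.indicator F) x ≤ B * localBound p α Q F
  average_le : ∀ P ∈ Q.descendants, (P.toSet \ E).Nonempty →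
    avgNorm p P.triple F ≤ K * avgNorm p Q.triple F

/-- The hypothesis is used on 3Q; the factor 3^n in `weakLevel` absorbs the passage from |3Q| to
|Q|. -/
theorem IsLocallyWeakBounded.measure_le {G : ((Fin n → ℝ) → 𝕜) → (Fin n → ℝ) → ℝ≥0∞}
    {φ : ℝ → ℝ≥0} (hG : IsLocallyWeakBounded p α φ G) (m : ℕ) (Q : Cube n)
    {F : (Fin n → ℝ) → 𝕜} (hF : BddSuppLp p F) :
    2 ^ (n + 5) * (m + 1) * volume {x ∈ Q.triple.toSet |
      φ (weakLevel n m) * localBound p α Q F < G (Q.triple.toSet.indicator F) x} ≤ Q.vol := by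
  have h := hG.2 _ ⟨weakLevel_pos n m, weakLevel_lt_one n m⟩ Q.triple F (hF.1.restrict _)
  simp only [mul_assoc] at h
  simp only [localBound]
  calc _ ≤ 2 ^ (n + 5) * (m + 1) * (ENNReal.ofReal (weakLevel n m) * Q.triple.vol) := by gcongr
    _ = ((2 ^ (n + 5) * 3 ^ n * (m + 1)) * ENNReal.ofReal (weakLevel n m)) * Q.vol := by
        rw [Cube.vol_triple]; ring
    _ = Q.vol := by rw [weakLevel_mul, one_mul]

/-- The third piece of the exceptional set consists of whole cubes with large average, so a single
point off the set controls every cube containing it. The factor m + 1 leaves room for a union over k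
≤ m. -/
theorem exists_isExceptional (hp : 1 ≤ p) (hpt : p ≠ ∞)
    (hφT : IsLocallyWeakBounded p α φT (fun f x => ‖T f x‖ₑ))
    (hφM : IsLocallyWeakBounded p α φM (sharpMaximal T q)) (m : ℕ) (Q : Cube n)
    {F : (Fin n → ℝ) → 𝕜} (hF : BddSuppLp p F) :
    ∃ E, IsExceptional p q α (φT (weakLevel n m)) (φM (weakLevel n m)) (avgGrowth n m) T F Q E ∧
      2 ^ (n + 3) * (m + 1) * volume E ≤ Q.vol := by
  set E₁ := {x ∈ Q.triple.toSet | φT (weakLevel n m) * localBound p α Q F <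
    ‖T (Q.triple.toSet.indicator F) x‖ₑ} with hE₁
  set E₂ := {x ∈ Q.triple.toSet | φM (weakLevel n m) * localBound p α Q F <
    sharpMaximal T q (Q.triple.toSet.indicator F) x} with hE₂
  set L := {P ∈ Q.descendants | avgGrowth n m * avgNorm p Q.triple F < avgNorm p P.triple F}
    with hL
  set E₃ := ⋃ P ∈ L, P.toSet with hE₃
  have h1 : 2 ^ (n + 5) * (m + 1) * volume E₁ ≤ Q.vol := hφT.measure_le m Q hF
  have h2 : 2 ^ (n + 5) * (m + 1) * volume E₂ ≤ Q.vol := hφM.measure_le m Q hF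
  have h3 : 2 ^ (n + 4) * (m + 1) * volume E₃ ≤ Q.vol := by
    have h := measure_iUnion_large_avgNorm_le hp hpt Q F (K := avgGrowth n m) (by
      exact_mod_cast Nat.one_le_iff_ne_zero.2 (by unfold avgGrowth; positivity))
    have e : (avgGrowth n m : ℝ≥0∞) * volume E₃ =
        15 ^ n * (2 ^ (n + 4) * (m + 1) * volume E₃) := by
      rw [avgGrowth]; push_cast; ring
    rw [e] at h
    exact (ENNReal.mul_le_mul_iff_right (by simp) (by simp)).1 h
  refine ⟨E₁ ∪ E₂ ∪ E₃, ⟨?_, ?_, ?_⟩, ?_⟩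
  · rintro x ⟨hxQ, hx⟩
    by_contra hlt
    exact hx (Or.inl (Or.inl ⟨Q.subset_triple hxQ, not_le.1 hlt⟩))
  · rintro x ⟨hxQ, hx⟩
    by_contra hlt
    exact hx (Or.inl (Or.inr ⟨Q.subset_triple hxQ, not_le.1 hlt⟩))
  · rintro P hP ⟨x, hxP, hx⟩
    by_contra hlt
    exact hx (Or.inr (mem_iUnion₂.2 ⟨P, ⟨hP, not_le.1 hlt⟩, hxP⟩))
  · have h4 : volume (E₁ ∪ E₂ ∪ E₃) ≤ volume E₁ + volume E₂ + volume E₃ :=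
      (measure_union_le _ _).trans (by gcongr; exact measure_union_le _ _)
    -- The three pieces take shares 1/4, 1/4 and 1/2 of the allowed measure.
    have h5 : 4 * (2 ^ (n + 3) * (m + 1) * volume (E₁ ∪ E₂ ∪ E₃)) ≤ 4 * Q.vol := by
      calc _ ≤ 4 * (2 ^ (n + 3) * (m + 1) * (volume E₁ + volume E₂ + volume E₃)) := by gcongr
        _ = 2 ^ (n + 5) * (m + 1) * volume E₁ + 2 ^ (n + 5) * (m + 1) * volume E₂ +
            2 * (2 ^ (n + 4) * (m + 1) * volume E₃) := by
            rw [pow_add 2 n 5, pow_add 2 n 4, pow_add 2 n 3]; ring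
        _ ≤ Q.vol + Q.vol + 2 * Q.vol := by gcongr
        _ = 4 * Q.vol := by ring
    exact (ENNReal.mul_le_mul_iff_right (by simp) (by simp)).1 h5

variable {G : Type*} [NormedAddCommGroup G]

/-- The far part of the operator on a stopping cube. -/
theorem setLIntegral_far_part_le [ENNReal.HolderConjugate q q'] (hα : 0 ≤ α)
    (hT : IsSublinear p T) (hφT : IsLocallyWeakBounded p α φT (fun f x => ‖T f x‖ₑ)) {m : ℕ}
    {B K : ℝ≥0∞} {Q P : Cube n} {F : (Fin n → ℝ) → 𝕜} (hF : BddSuppLp p F)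
    {E : Set (Fin n → ℝ)}
    (hE : IsExceptional p q α (φT (weakLevel n m)) B K T F Q E)
    (hP : P ∈ Q.descendants) (hPE : 4 * volume (P.toSet ∩ E) ≤ P.vol)
    {w : (Fin n → ℝ) → G} (hw : AEStronglyMeasurable w volume) :
    ∫⁻ x in P.toSet, ‖T (P.triple.toSetᶜ.indicator (Q.triple.toSet.indicator F)) x‖ₑ * ‖w x‖ₑ ≤
      ((2 * B + (1 + K) * φT (weakLevel n m)) * localBound p α Q F) *
        (P.vol * avgNorm q' P w) := by
  have hPQ := Cube.subset_of_mem_descendants hP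
  -- `E` fills at most a quarter of `P`. A point of `P` off `E` gives access to the average bound
  -- and, with `P` itself in the supremum, to the oscillation bound.
  have hne : (P.toSet \ E).Nonempty := by
    rw [sdiff_nonempty]
    intro hsub
    rw [inter_eq_left.2 hsub] at hPE
    change 4 * P.vol ≤ P.vol at hPE
    have h1 : 2 * P.vol ≤ 1 * P.vol := by
      rw [one_mul]; refine le_trans ?_ hPE; gcongr; norm_num
    rw [ENNReal.mul_le_mul_iff_left P.vol_ne_zero P.vol_ne_top] at h1
    exact absurd h1 (by norm_num)
  have havg := hE.average_le P hP hne
  obtain ⟨x₀, hx₀P, hx₀E⟩ := hne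
  set F' := Q.triple.toSet.indicator F with hF'
  have hF'b : BddSuppLp p F' := hF.indicator Q.triple.measurableSet_toSet
  have hnear : P.triple.toSet.indicator F' = P.triple.toSet.indicator F := by
    rw [hF', indicator_indicator, inter_eq_left.2 (Cube.triple_subset_triple hPQ)]
  have hfarb : BddSuppLp p (P.triple.toSetᶜ.indicator F') :=
    hF'b.indicator P.triple.measurableSet_toSet.compl
  have hosc : osc q (T (P.triple.toSetᶜ.indicator F')) P ≤ B * localBound p α Q F :=
    le_trans (le_iSup₂_of_le P hx₀P le_rfl) (hE.maximal_le x₀ ⟨hPQ hx₀P, hx₀E⟩)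
  set N₁ := {x ∈ P.triple.toSet | φT (weakLevel n m) * localBound p α P F <
    ‖T (P.triple.toSet.indicator F) x‖ₑ} with hN₁
  have hN₁v : 4 * volume N₁ ≤ P.vol := by
    refine le_trans ?_ (hφT.measure_le m P hF)
    gcongr
    have h1 : (4 : ℝ≥0∞) ≤ 2 ^ (n + 5) := by
      calc (4 : ℝ≥0∞) = 2 ^ 2 := by norm_num
        _ ≤ _ := pow_le_pow_right₀ (by norm_num) (by omega)
    calc (4 : ℝ≥0∞) = 4 * 1 := by ring
      _ ≤ _ := by gcongr; exact le_add_self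
  have hsub := hT.ae_norm_le_add hfarb (hF'b.indicator P.triple.measurableSet_toSet)
  rw [indicator_compl_add_self, hnear] at hsub
  set N₂ := {x | ¬ ‖T (P.triple.toSetᶜ.indicator F') x‖ ≤
    ‖T F' x‖ + ‖T (P.triple.toSet.indicator F) x‖} with hN₂
  have hN₂v : volume N₂ = 0 := ae_iff.1 hsub
  -- A quarter for `E`, a quarter for the weak type set of `T` on 3P, and a null set for
  -- sublinearity: the far part is bounded on the remaining half.
  have hN : 2 * volume (P.toSet ∩ E ∪ N₁ ∪ N₂) ≤ P.vol := by
    have h1 : volume (P.toSet ∩ E ∪ N₁ ∪ N₂) ≤ volume (P.toSet ∩ E) + volume N₁ := by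
      refine (measure_union_le _ _).trans ?_
      rw [hN₂v, add_zero]
      exact measure_union_le _ _
    refine (ENNReal.mul_le_mul_iff_right (a := 2) (by simp) (by simp)).1 ?_
    calc _ ≤ 2 * (2 * (volume (P.toSet ∩ E) + volume N₁)) := by gcongr
      _ = 4 * volume (P.toSet ∩ E) + 4 * volume N₁ := by ring
      _ ≤ P.vol + P.vol := by gcongr
      _ = _ := by ring
  -- The averages grow by at most K, and since α ≥ 0 the power of the volume is monotone.
  have hlb : localBound p α P F ≤ K * localBound p α Q F := by
    rw [localBound, localBound, ← mul_assoc]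
    gcongr
    exact measure_mono (Cube.triple_subset_triple hPQ)
  have hbound : ∀ x ∈ P.toSet \ (P.toSet ∩ E ∪ N₁ ∪ N₂),
      ‖T (P.triple.toSetᶜ.indicator F') x‖ₑ ≤
        (1 + K) * φT (weakLevel n m) * localBound p α Q F := by
    rintro x ⟨hxP, hx⟩
    simp only [mem_union, not_or] at hx
    obtain ⟨⟨hxE, hx1⟩, hx2⟩ := hx
    have h1 := hE.operator_le x ⟨hPQ hxP, fun h => hxE ⟨hxP, h⟩⟩
    have h2 : ‖T (P.triple.toSet.indicator F) x‖ₑ ≤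
        φT (weakLevel n m) * localBound p α P F := by
      by_contra hlt
      exact hx1 ⟨P.subset_triple hxP, not_le.1 hlt⟩
    have h3 : ‖T (P.triple.toSetᶜ.indicator F') x‖ ≤
        ‖T F' x‖ + ‖T (P.triple.toSet.indicator F) x‖ := not_not.1 hx2
    calc ‖T (P.triple.toSetᶜ.indicator F') x‖ₑ
        ≤ ‖T F' x‖ₑ + ‖T (P.triple.toSet.indicator F) x‖ₑ := by
          rw [← ofReal_norm, ← ofReal_norm, ← ofReal_norm,
            ← ENNReal.ofReal_add (norm_nonneg _) (norm_nonneg _)]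
          exact ENNReal.ofReal_le_ofReal h3
      _ ≤ φT (weakLevel n m) * localBound p α Q F +
          φT (weakLevel n m) * (K * localBound p α Q F) :=
          add_le_add h1 (h2.trans (by gcongr))
      _ = _ := by ring
  refine (setLIntegral_enorm_mul_le_osc (q := q) (q' := q') P (hT.measurable _ hfarb) hw hN
    hbound).trans ?_
  gcongr
  calc _ ≤ 2 * (B * localBound p α Q F) + (1 + K) * φT (weakLevel n m) * localBound p α Q F := by
        gcongr
    _ = _ := by ring

end Step

end SparseDom

/-! ### One step of the stopping-time argument -/

namespace SparseDom

variable {n : ℕ} {𝕜 : Type*} [RCLike 𝕜]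

/-- The function which dominates the near part of `T F` on `Q` and the far parts on the
stopping cubes `S`. -/
noncomputable def stepMajorant (T : ((Fin n → ℝ) → 𝕜) → (Fin n → ℝ) → 𝕜)
    (F : (Fin n → ℝ) → 𝕜) (Q : Cube n) (S : Set (Cube n)) (x : Fin n → ℝ) : ℝ≥0∞ :=
  (Q.toSet \ ⋃ P ∈ S, P.toSet).indicator
      (fun x => ‖T (Q.triple.toSet.indicator F) x‖ₑ) x +
    ∑' P : S, (P : Cube n).toSet.indicator
      (fun x => ‖T ((P : Cube n).triple.toSetᶜ.indicator (Q.triple.toSet.indicator F)) x‖ₑ) x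

variable {p q q' : ℝ≥0∞} {α : ℝ} {φT φM : ℝ → ℝ≥0}
  {T : ((Fin n → ℝ) → 𝕜) → (Fin n → ℝ) → 𝕜}

theorem measurableSet_biUnion_toSet {S : Set (Cube n)} (hS : S.Countable) :
    MeasurableSet (⋃ P ∈ S, P.toSet) :=
  MeasurableSet.biUnion hS fun P _ => P.measurableSet_toSet

theorem aemeasurable_stepMajorant (hT : IsSublinear p T) {F : (Fin n → ℝ) → 𝕜}
    (hF : BddSuppLp p F) (Q : Cube n) {S : Set (Cube n)} (hS : S.Countable) :
    AEMeasurable (stepMajorant T F Q S) volume := by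
  have := hS.to_subtype
  have hF' := hF.indicator Q.triple.measurableSet_toSet
  refine AEMeasurable.add ?_ (AEMeasurable.tsum fun P => ?_)
  · exact (hT.measurable _ hF').enorm.indicator
      (Q.measurableSet_toSet.diff (measurableSet_biUnion_toSet hS))
  · exact (hT.measurable _ (hF'.indicator
      (P : Cube n).triple.measurableSet_toSet.compl)).enorm.indicator
      (P : Cube n).measurableSet_toSet

/-- The near part is bounded pointwise almost everywhere because the stopping cubes cover `E` up to
a null set. The far parts are estimated cube by cube and summed by `tsum_vol_mul_avgNorm_le`. -/
theorem setLIntegral_stepMajorant_le [ENNReal.HolderConjugate q q'] (hq' : q' ≠ ∞) (hα : 0 ≤ α)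
    (hT : IsSublinear p T) (hφT : IsLocallyWeakBounded p α φT (fun f x => ‖T f x‖ₑ)) {m : ℕ}
    {B K : ℝ≥0∞} {Q : Cube n} {F : (Fin n → ℝ) → 𝕜} (hF : BddSuppLp p F)
    {E : Set (Fin n → ℝ)}
    (hE : IsExceptional p q α (φT (weakLevel n m)) B K T F Q E)
    {S : Set (Cube n)} (hSQ : S ⊆ Q.descendants) (hdisj : S.PairwiseDisjoint Cube.toSet)
    (hSE : ∀ P ∈ S, 4 * volume (P.toSet ∩ E) ≤ P.vol)
    (hcov : volume (E \ ⋃ P ∈ S, P.toSet) = 0)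
    {G : Type*} [NormedAddCommGroup G]
    {w : (Fin n → ℝ) → G} (hw : AEStronglyMeasurable w volume) :
    ∫⁻ x in Q.toSet, stepMajorant T F Q S x * ‖w x‖ₑ ≤
      (2 + K) * (φT (weakLevel n m) + B) * localBound p α Q F *
        (Q.vol * avgNorm q' Q w) := by
  have hSc := Cube.countable_of_subset_descendants hSQ
  have := hSc.to_subtype
  have hq1 : 1 ≤ q' := ENNReal.HolderConjugate.one_le q' q
  have hF' := hF.indicator Q.triple.measurableSet_toSet
  have hUm := measurableSet_biUnion_toSet hSc
  set A : ℝ≥0∞ := ENNReal.ofNNReal (φT (weakLevel n m)) with hA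
  set V := Q.vol * avgNorm q' Q w with hV
  have hnear : ∫⁻ x in Q.toSet, (Q.toSet \ ⋃ P ∈ S, P.toSet).indicator
      (fun x => ‖T (Q.triple.toSet.indicator F) x‖ₑ) x * ‖w x‖ₑ ≤
      A * localBound p α Q F * V := by
    refine le_trans ?_ (mul_le_mul_right (setLIntegral_enorm_le_avgNorm hq1 Q hw) _)
    rw [← lintegral_const_mul'' _ hw.restrict.enorm]
    refine lintegral_mono_ae (ae_restrict_of_ae ?_)
    filter_upwards [measure_eq_zero_iff_ae_notMem.1 hcov] with x hx
    gcongr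
    by_cases h : x ∈ Q.toSet \ ⋃ P ∈ S, P.toSet
    · rw [indicator_of_mem h]
      exact hE.operator_le x ⟨h.1, fun hxE => hx ⟨hxE, h.2⟩⟩
    · rw [indicator_of_notMem h]
      exact zero_le
  have hfar : ∀ P : S, ∫⁻ x in Q.toSet, (P : Cube n).toSet.indicator
      (fun x => ‖T ((P : Cube n).triple.toSetᶜ.indicator (Q.triple.toSet.indicator F)) x‖ₑ) x *
        ‖w x‖ₑ ≤ ((2 * B + (1 + K) * A) * localBound p α Q F) *
          ((P : Cube n).vol * avgNorm q' P w) := by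
    intro P
    refine le_trans (le_of_eq ?_) (setLIntegral_far_part_le hα hT hφT hF hE (hSQ P.2)
      (hSE P P.2) hw)
    have e : ∀ x, (P : Cube n).toSet.indicator (fun x => ‖T ((P : Cube n).triple.toSetᶜ.indicator
        (Q.triple.toSet.indicator F)) x‖ₑ) x * ‖w x‖ₑ = (P : Cube n).toSet.indicator (fun x =>
        ‖T ((P : Cube n).triple.toSetᶜ.indicator (Q.triple.toSet.indicator F)) x‖ₑ * ‖w x‖ₑ) x :=
      fun x => by by_cases hx : x ∈ (P : Cube n).toSet <;> simp [hx]
    simp_rw [e]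
    rw [lintegral_indicator (P : Cube n).measurableSet_toSet,
      Measure.restrict_restrict (P : Cube n).measurableSet_toSet,
      inter_eq_left.2 (Cube.subset_of_mem_descendants (hSQ P.2))]
  simp only [stepMajorant, add_mul, ← ENNReal.tsum_mul_right]
  rw [lintegral_add_left', lintegral_tsum]
  · calc _ ≤ A * localBound p α Q F * V + ∑' P : S, ((2 * B + (1 + K) * A) * localBound p α Q F) *
          ((P : Cube n).vol * avgNorm q' P w) := add_le_add hnear (ENNReal.tsum_le_tsum hfar)
      _ ≤ A * localBound p α Q F * V + ((2 * B + (1 + K) * A) * localBound p α Q F) * V := by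
          rw [ENNReal.tsum_mul_left]
          gcongr
          exact tsum_vol_mul_avgNorm_le hq1 hq' hSc hdisj Q
            (fun P hP => Cube.subset_of_mem_descendants (hSQ hP)) w
      _ = (2 * B + (2 + K) * A) * localBound p α Q F * V := by ring
      _ ≤ (2 * B + K * B + (2 + K) * A) * localBound p α Q F * V := by
          gcongr
          exact le_self_add
      _ = _ := by ring
  · intro P
    exact ((((hT.measurable _ (hF'.indicator
      (P : Cube n).triple.measurableSet_toSet.compl)).enorm.indicator
      (P : Cube n).measurableSet_toSet).mul hw.enorm)).restrict
  · exact (((hT.measurable _ hF').enorm.indicator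
      (Q.measurableSet_toSet.diff hUm)).mul hw.enorm).restrict

/-- The contribution of a single cube to the sparse forms. -/
noncomputable def formTerm (b : (Fin n → ℝ) → 𝕜) (m : ℕ) (p r : ℝ≥0∞) (α : ℝ)
    (f g : (Fin n → ℝ) → 𝕜) (R : Cube n) : ℝ≥0∞ :=
  avgNorm p R (oscWeight b m R f) * avgNorm r R g * R.vol ^ (1 + α / n) +
    avgNorm p R f * avgNorm r R (oscWeight b m R g) * R.vol ^ (1 + α / n)

/-- The average of the weight is enlarged from Q to 3Q, so that both factors live on the same cube
and can be interpolated. -/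
theorem localBound_mul_le (hp : 1 ≤ p) (hpt : p ≠ ∞) (hq1 : 1 ≤ q') (hq' : q' ≠ ∞)
    {b f g : (Fin n → ℝ) → 𝕜} (hb : AEStronglyMeasurable b volume)
    (hf : AEStronglyMeasurable f volume) (hg : AEStronglyMeasurable g volume) (Q : Cube n)
    {k m : ℕ} (hk : k ≤ m) :
    localBound p α Q (fun y => (b y - ⨍ z in Q.triple.toSet, b z) ^ k * f y) *
      (Q.vol * avgNorm q' Q fun x => ‖b x - ⨍ z in Q.triple.toSet, b z‖ ^ (m - k) * ‖g x‖) ≤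
      formTerm b m p q' α f g Q.triple := by
  set c := ⨍ z in Q.triple.toSet, b z with hc
  have h1 : avgNorm p Q.triple (fun y => (b y - c) ^ k * f y) =
      avgNorm p Q.triple (fun y => ‖b y - c‖ ^ k * ‖f y‖) :=
    eLpNorm_congr_norm_ae (Filter.Eventually.of_forall fun x => by simp)
  have h2 := avgNorm_mul_avgNorm_le (zero_lt_one.trans_le hp).ne' hpt (zero_lt_one.trans_le hq1).ne'
    hq' Q.triple (hb.sub (aestronglyMeasurable_const (b := c))) hf hg hk
  simp only [Pi.sub_apply] at h2
  rw [localBound, h1]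
  calc _ ≤ _ * (Q.triple.vol *
        avgNorm q' Q.triple fun x => ‖b x - c‖ ^ (m - k) * ‖g x‖) :=
        mul_le_mul_right (vol_mul_avgNorm_mono hq1 hq' Q.subset_triple _) _
    _ = avgNorm p Q.triple (fun y => ‖b y - c‖ ^ k * ‖f y‖) *
        avgNorm q' Q.triple (fun x => ‖b x - c‖ ^ (m - k) * ‖g x‖) *
          Q.triple.vol ^ (1 + α / n) := by
        rw [ENNReal.rpow_add _ _ Q.triple.vol_ne_zero Q.triple.vol_ne_top, ENNReal.rpow_one]
        ring
    _ ≤ _ := by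
        rw [formTerm, ← add_mul]
        exact mul_le_mul_left h2 _

theorem mul_indicator_eq (u : (Fin n → ℝ) → 𝕜) (s : Set (Fin n → ℝ)) (f : (Fin n → ℝ) → 𝕜) :
    (fun y => u y * s.indicator f y) = s.indicator fun y => u y * f y := by
  ext y
  by_cases h : y ∈ s <;> simp [h]

/-- The basic step of the sparse domination: a stopping family in `Q` such that the commutator on
`3Q` is dominated by an integrable majorant and the commutators on the triples of the stopping
cubes. -/
theorem exists_stopping_family [ENNReal.HolderConjugate q q'] (hp : 1 ≤ p) (hpt : p ≠ ∞)
    (hq' : q' ≠ ∞) (hα : 0 ≤ α) (hT : IsSublinear p T)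
    (hφT : IsLocallyWeakBounded p α φT (fun f x => ‖T f x‖ₑ))
    (hφM : IsLocallyWeakBounded p α φM (sharpMaximal T q)) {m : ℕ}
    {b f g : (Fin n → ℝ) → 𝕜} (hb : AEStronglyMeasurable b volume)
    (hf : AEStronglyMeasurable f volume) (hg : AEStronglyMeasurable g volume)
    (hbf : ∀ c : 𝕜, ∀ k ≤ m, BddSuppLp p fun y => (b y - c) ^ k * f y) (Q : Cube n) :
    ∃ S ⊆ Q.descendants, S.PairwiseDisjoint Cube.toSet ∧
      2 * volume (⋃ P ∈ S, P.toSet) ≤ Q.vol ∧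
      ∃ a : (Fin n → ℝ) → ℝ≥0∞, AEMeasurable a volume ∧
        (∀ᵐ x, (x ∈ Q.toSet \ ⋃ P ∈ S, P.toSet →
            ‖commutator T b m (Q.triple.toSet.indicator f) x‖ₑ ≤ a x) ∧
          ∀ P ∈ S, x ∈ P.toSet → ‖commutator T b m (Q.triple.toSet.indicator f) x‖ₑ ≤
            a x + ‖commutator T b m (P.triple.toSet.indicator f) x‖ₑ) ∧
        ∫⁻ x in Q.toSet, a x * ‖g x‖ₑ ≤
          2 ^ m * (2 + avgGrowth n m) * (φT (weakLevel n m) + φM (weakLevel n m)) *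
            formTerm b m p q' α f g Q.triple := by
  -- The mean is taken over 3Q because the triples, not the cubes themselves, enter the final sparse
  -- family.
  set c := ⨍ z in Q.triple.toSet, b z with hc
  set F : ℕ → (Fin n → ℝ) → 𝕜 := fun k y => (b y - c) ^ k * f y with hFdef
  have hF : ∀ k ≤ m, BddSuppLp p (F k) := hbf c
  have hFi : ∀ k ≤ m, ∀ s : Set (Fin n → ℝ), MeasurableSet s →
      BddSuppLp p fun y => (b y - c) ^ k * s.indicator f y := by
    intro k hk s hs
    rw [mul_indicator_eq (fun y => (b y - c) ^ k)]
    exact (hF k hk).indicator hs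
  choose! E hE hEv using fun k (hk : k ≤ m) =>
    exists_isExceptional (α := α) hp hpt hφT hφM m Q (hF k hk)
  set E₀ : Set (Fin n → ℝ) := ⋃ k ∈ Finset.range (m + 1), E k ∩ Q.toSet with hE₀
  have hE₀v : 2 ^ (n + 3) * volume E₀ ≤ Q.vol := by
    have h1 : volume E₀ ≤ ∑ k ∈ Finset.range (m + 1), volume (E k) :=
      (measure_biUnion_finset_le _ _).trans
        (Finset.sum_le_sum fun k _ => measure_mono inter_subset_left)
    have h2 : (m + 1 : ℝ≥0∞) * (2 ^ (n + 3) * volume E₀) ≤ (m + 1 : ℝ≥0∞) * Q.vol := by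
      calc (m + 1 : ℝ≥0∞) * (2 ^ (n + 3) * volume E₀)
          ≤ (m + 1 : ℝ≥0∞) * (2 ^ (n + 3) * ∑ k ∈ Finset.range (m + 1), volume (E k)) := by
            gcongr
        _ = ∑ k ∈ Finset.range (m + 1), 2 ^ (n + 3) * (m + 1) * volume (E k) := by
            rw [← Finset.mul_sum]; ring
        _ ≤ ∑ k ∈ Finset.range (m + 1), Q.vol :=
            Finset.sum_le_sum fun k hk => hEv k (by simpa [Nat.lt_succ_iff] using hk)
        _ = (m + 1 : ℝ≥0∞) * Q.vol := by simp
    exact (ENNReal.mul_le_mul_iff_right (by simp) (by simp [ENNReal.add_eq_top])).1 h2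
  -- One measurable set serves all k at once, so a single stopping family controls every F k.
  set E' := toMeasurable volume E₀ ∩ Q.toSet with hE'
  have hE'v : 2 ^ (n + 3) * volume E' ≤ Q.vol := by
    refine le_trans (mul_le_mul_right ?_ _) hE₀v
    exact (measure_mono inter_subset_left).trans (measure_toMeasurable E₀).le
  have hEE' : ∀ k ≤ m, E k ∩ Q.toSet ⊆ E' := fun k hk x hx =>
    ⟨subset_toMeasurable _ _ (mem_iUnion₂.2
      ⟨k, Finset.mem_range.2 (Nat.lt_succ_of_le hk), hx⟩), hx.2⟩
  obtain ⟨S, hSQ, hdisj, hSv, hSE, hcov⟩ := Q.exists_stopping_cubes (E := E')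
    ((measurableSet_toMeasurable volume E₀).inter Q.measurableSet_toSet) inter_subset_right hE'v
  have hSc := Cube.countable_of_subset_descendants hSQ
  have hsubs : ∀ P ∈ S, P.toSet ⊆ Q.toSet := fun P hP =>
    Cube.subset_of_mem_descendants (hSQ hP)
  have hexc : ∀ k ≤ m, IsExceptional p q α (φT (weakLevel n m)) (φM (weakLevel n m))
      (avgGrowth n m) T (F k) Q E' := by
    intro k hk
    have h := hE k hk
    refine ⟨fun x hx => h.1 x ⟨hx.1, fun hxE => hx.2 (hEE' k hk ⟨hxE, hx.1⟩)⟩,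
      fun x hx => h.2 x ⟨hx.1, fun hxE => hx.2 (hEE' k hk ⟨hxE, hx.1⟩)⟩, fun P hP hne => ?_⟩
    obtain ⟨x, hxP, hx⟩ := hne
    exact h.3 P hP ⟨x, hxP, fun hxE =>
      hx (hEE' k hk ⟨hxE, Cube.subset_of_mem_descendants hP hxP⟩)⟩
  set a : (Fin n → ℝ) → ℝ≥0∞ := fun x => ∑ k ∈ Finset.range (m + 1),
    (m.choose k : ℝ≥0∞) * ‖b x - c‖ₑ ^ (m - k) * stepMajorant T (F k) Q S x with ha
  have hbc : AEStronglyMeasurable (fun x => b x - c) volume :=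
    hb.sub (aestronglyMeasurable_const (b := c))
  have hmem : ∀ k ∈ Finset.range (m + 1), k ≤ m := fun k hk =>
    Nat.lt_succ_iff.1 (Finset.mem_range.1 hk)
  refine ⟨S, hSQ, hdisj, hSv, a, ?_, ?_, ?_⟩
  · refine Finset.aemeasurable_fun_sum _ fun k hk => ?_
    exact ((hbc.enorm.pow_const _).const_mul _).mul
      (aemeasurable_stepMajorant hT (hF k (hmem k hk)) Q hSc)
  · have h1 := ae_enorm_commutator_le (b := b) (m := m) hT c
      (f := Q.triple.toSet.indicator f) fun k hk => hFi k hk _ Q.triple.measurableSet_toSet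
    have h2 : ∀ᵐ x, ∀ P ∈ S, ‖commutator T b m (P.triple.toSetᶜ.indicator
        (Q.triple.toSet.indicator f)) x‖ₑ ≤ ∑ k ∈ Finset.range (m + 1),
        (m.choose k : ℝ≥0∞) * ‖b x - c‖ₑ ^ (m - k) * ‖T (fun y => (b y - c) ^ k *
          P.triple.toSetᶜ.indicator (Q.triple.toSet.indicator f) y) x‖ₑ := by
      refine (ae_ball_iff hSc).2 fun P _ => ae_enorm_commutator_le hT c fun k hk => ?_
      rw [indicator_indicator]
      exact hFi k hk _ (P.triple.measurableSet_toSet.compl.inter Q.triple.measurableSet_toSet)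
    -- Only the far commutator is expanded about c. The commutator on 3P is kept whole for the
    -- recursion, where its own mean is used.
    have h3 : ∀ᵐ x, ∀ P ∈ S, ‖commutator T b m (Q.triple.toSet.indicator f) x‖ₑ ≤
        ‖commutator T b m (P.triple.toSetᶜ.indicator (Q.triple.toSet.indicator f)) x‖ₑ +
          ‖commutator T b m (P.triple.toSet.indicator f) x‖ₑ := by
      refine (ae_ball_iff hSc).2 fun P hP => ?_
      have e : P.triple.toSetᶜ.indicator (Q.triple.toSet.indicator f) +
          P.triple.toSet.indicator f = Q.triple.toSet.indicator f := by
        conv_rhs => rw [← indicator_compl_add_self P.triple.toSet (Q.triple.toSet.indicator f)]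
        rw [indicator_indicator P.triple.toSet,
          inter_eq_left.2 (Cube.triple_subset_triple (hsubs P hP))]
      have := ae_enorm_commutator_add_le (b := b) (m := m) hT c
        (f := P.triple.toSetᶜ.indicator (Q.triple.toSet.indicator f))
        (g := P.triple.toSet.indicator f) (fun k hk => by
          rw [indicator_indicator]
          exact hFi k hk _
            (P.triple.measurableSet_toSet.compl.inter Q.triple.measurableSet_toSet))
        (fun k hk => hFi k hk _ P.triple.measurableSet_toSet)
      rwa [e] at this
    filter_upwards [h1, h2, h3] with x hx1 hx2 hx3
    refine ⟨fun hx => hx1.trans (Finset.sum_le_sum fun k hk => ?_), fun P hP hxP =>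
      (hx3 P hP).trans (add_le_add_left ((hx2 P hP).trans
        (Finset.sum_le_sum fun k hk => ?_)) _)⟩
    · gcongr
      rw [mul_indicator_eq (fun y => (b y - c) ^ k), stepMajorant, indicator_of_mem hx]
      exact le_self_add
    · gcongr
      rw [mul_indicator_eq (fun y => (b y - c) ^ k), mul_indicator_eq (fun y => (b y - c) ^ k),
        stepMajorant]
      refine le_trans ?_ le_add_self
      refine le_trans (le_of_eq ?_) (ENNReal.le_tsum (⟨P, hP⟩ : S))
      rw [indicator_of_mem hxP]
  · have e : ∀ x, a x * ‖g x‖ₑ = ∑ k ∈ Finset.range (m + 1), (m.choose k : ℝ≥0∞) *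
        (stepMajorant T (F k) Q S x * ‖‖b x - c‖ ^ (m - k) * ‖g x‖‖ₑ) := by
      intro x
      rw [ha, Finset.sum_mul]
      refine Finset.sum_congr rfl fun k _ => ?_
      rw [enorm_mul, enorm_pow, enorm_norm, enorm_norm]
      ring
    have hw : ∀ k, AEStronglyMeasurable (fun x => ‖b x - c‖ ^ (m - k) * ‖g x‖) volume :=
      fun k => (hbc.norm.pow _).mul hg.norm
    simp_rw [e]
    have hm : ∀ k ∈ Finset.range (m + 1), AEMeasurable (fun x => (m.choose k : ℝ≥0∞) *
        (stepMajorant T (F k) Q S x * ‖‖b x - c‖ ^ (m - k) * ‖g x‖‖ₑ))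
        (volume.restrict Q.toSet) := fun k hk =>
      (((aemeasurable_stepMajorant hT (hF k (hmem k hk)) Q hSc).mul
        (hw k).enorm).const_mul _).restrict
    rw [lintegral_finsetSum' _ hm]
    calc _ ≤ ∑ k ∈ Finset.range (m + 1), (m.choose k : ℝ≥0∞) *
          ((2 + avgGrowth n m) * (φT (weakLevel n m) + φM (weakLevel n m)) *
            formTerm b m p q' α f g Q.triple) := by
          refine Finset.sum_le_sum fun k hk => ?_
          rw [lintegral_const_mul' _ _ (by simp)]
          gcongr
          refine (setLIntegral_stepMajorant_le hq' hα hT hφT (hF k (hmem k hk))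
            (hexc k (hmem k hk)) hSQ hdisj hSE hcov (hw k)).trans ?_
          rw [mul_assoc]
          gcongr
          exact localBound_mul_le hp hpt (ENNReal.HolderConjugate.one_le q' q) hq' hb hf hg Q
            (hmem k hk)
      _ = _ := by
          rw [← Finset.sum_mul, ← Nat.cast_sum, Nat.sum_range_choose]
          push_cast
          ring

end SparseDom

/-! ### Iteration along the tree of stopping cubes -/

namespace SparseDom

variable {n : ℕ}

section Tree

/-- The cubes obtained from `Q` by iterating a selection of subcubes. -/
def tree (ch : Cube n → Set (Cube n)) (Q : Cube n) : Set (Cube n) :=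
  {R | Relation.ReflTransGen (fun R P => R ∈ ch P) R Q}

/-- The points of `Q` covered by the `N`-th generation of selected cubes. -/
def generation (ch : Cube n → Set (Cube n)) : ℕ → Cube n → Set (Fin n → ℝ)
  | 0, Q => Q.toSet
  | N + 1, Q => ⋃ P ∈ ch Q, generation ch N P

variable {ch : Cube n → Set (Cube n)}

theorem self_mem_tree (Q : Cube n) : Q ∈ tree ch Q := Relation.ReflTransGen.refl

theorem tree_subset_tree {R Q : Cube n} (h : R ∈ tree ch Q) : tree ch R ⊆ tree ch Q :=
  fun _ hP => Relation.ReflTransGen.trans hP h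

theorem tree_subset_descendants (hch : ∀ Q, ch Q ⊆ Q.descendants) (Q : Cube n) :
    tree ch Q ⊆ Q.descendants := by
  intro R hR
  induction hR with
  | refl => exact Cube.descendants_self _
  | tail _ h ih => exact Cube.mem_descendants_trans ih (hch _ h)

theorem mem_tree_or_disjoint (hch : ∀ Q, ch Q ⊆ Q.descendants)
    (hdisj : ∀ Q, (ch Q).PairwiseDisjoint Cube.toSet) {Q R R' : Cube n} (hR : R ∈ tree ch Q)
    (hR' : R' ∈ tree ch Q) :
    R' ∈ tree ch R ∨ R ∈ tree ch R' ∨ Disjoint R.toSet R'.toSet := by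
  induction hR' using Relation.ReflTransGen.head_induction_on with
  | refl => exact Or.inr (Or.inl hR)
  | @head R' R'' h _ ih =>
    rcases ih with ih | ih | ih
    · exact Or.inl (Relation.ReflTransGen.head h ih)
    · rcases Relation.ReflTransGen.cases_tail ih with rfl | ⟨P, hP, hPR⟩
      · exact Or.inl (Relation.ReflTransGen.single h)
      · by_cases hne : P = R'
        · exact Or.inr (Or.inl (hne ▸ hP))
        · exact Or.inr (Or.inr ((hdisj R'' hPR h hne).mono_left
            (Cube.subset_of_mem_descendants (tree_subset_descendants hch P hP))))
    · exact Or.inr (Or.inr (ih.mono_right (Cube.subset_of_mem_descendants (hch _ h))))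

/-- If one cube lies below another in the tree, it lies in a child of the latter, and children are
removed. Otherwise the cubes themselves are disjoint. -/
theorem pairwiseDisjoint_tree (hch : ∀ Q, ch Q ⊆ Q.descendants)
    (hdisj : ∀ Q, (ch Q).PairwiseDisjoint Cube.toSet) (Q : Cube n) :
    (tree ch Q).PairwiseDisjoint fun R => R.toSet \ ⋃ P ∈ ch R, P.toSet := by
  have key : ∀ R R' : Cube n, R ≠ R' → R' ∈ tree ch R →
      Disjoint (R.toSet \ ⋃ P ∈ ch R, P.toSet) (R'.toSet \ ⋃ P ∈ ch R', P.toSet) := by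
    intro R R' hne h
    rcases Relation.ReflTransGen.cases_tail h with h | ⟨P, hP, hPR⟩
    · exact absurd h hne
    · refine (disjoint_sdiff_left (s := ⋃ P ∈ ch R, P.toSet)).mono_right
        (sdiff_subset.trans (Subset.trans ?_ (subset_biUnion_of_mem hPR)))
      exact Cube.subset_of_mem_descendants (tree_subset_descendants hch P hP)
  intro R hR R' hR' hne
  rcases mem_tree_or_disjoint hch hdisj hR hR' with h | h | h
  · exact key R R' hne h
  · exact (key R' R hne.symm h).symm
  · exact h.mono sdiff_subset sdiff_subset

theorem two_pow_mul_volume_generation_le (hch : ∀ Q, ch Q ⊆ Q.descendants)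
    (hdisj : ∀ Q, (ch Q).PairwiseDisjoint Cube.toSet)
    (hvol : ∀ Q, 2 * volume (⋃ P ∈ ch Q, P.toSet) ≤ Q.vol) (N : ℕ) (Q : Cube n) :
    2 ^ N * volume (generation ch N Q) ≤ Q.vol := by
  induction N generalizing Q with
  | zero => simp [generation, Cube.vol]
  | succ N ih =>
    have hc : (ch Q).Countable := Cube.countable_of_subset_descendants (hch Q)
    refine le_trans ?_ (hvol Q)
    rw [measure_biUnion hc (hdisj Q) fun P _ => P.measurableSet_toSet, pow_succ', mul_assoc]
    gcongr
    calc 2 ^ N * volume (generation ch (N + 1) Q)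
        ≤ 2 ^ N * ∑' P : ch Q, volume (generation ch N P) := by
          gcongr
          exact measure_biUnion_le _ hc _
      _ = ∑' P : ch Q, 2 ^ N * volume (generation ch N P) := ENNReal.tsum_mul_left.symm
      _ ≤ _ := ENNReal.tsum_le_tsum fun P => ih P

/-- Otherwise the children of `R` would cover `R`, although they fill at most half of it. This keeps
a cube from being counted again below its own child. -/
theorem notMem_tree_of_mem (hch : ∀ Q, ch Q ⊆ Q.descendants)
    (hvol : ∀ Q, 2 * volume (⋃ P ∈ ch Q, P.toSet) ≤ Q.vol) {P R : Cube n} (hP : P ∈ ch R) :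
    R ∉ tree ch P := by
  intro h
  have h1 : R.toSet ⊆ ⋃ P ∈ ch R, P.toSet :=
    (Cube.subset_of_mem_descendants (tree_subset_descendants hch P h)).trans
      (subset_biUnion_of_mem hP)
  have h2 : 2 * R.vol ≤ 1 * R.vol := by
    rw [one_mul]
    refine le_trans ?_ (hvol R)
    gcongr
    exact measure_mono h1
  rw [ENNReal.mul_le_mul_iff_left R.vol_ne_zero R.vol_ne_top] at h2
  exact absurd h2 (by norm_num)

/-- Iteration of a pointwise recursive bound along a tree of cubes. -/
theorem le_tsum_tree (hch : ∀ Q, ch Q ⊆ Q.descendants)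
    (hvol : ∀ Q, 2 * volume (⋃ P ∈ ch Q, P.toSet) ≤ Q.vol) {u a : Cube n → ℝ≥0∞} {Q : Cube n}
    {x : Fin n → ℝ}
    (h1 : ∀ R ∈ tree ch Q, x ∈ R.toSet \ ⋃ P ∈ ch R, P.toSet → u R ≤ a R)
    (h2 : ∀ R ∈ tree ch Q, ∀ P ∈ ch R, x ∈ P.toSet → u R ≤ a R + u P) (N : ℕ) (hx : x ∈ Q.toSet)
    (hN : x ∉ generation ch N Q) :
    u Q ≤ ∑' R : tree ch Q, (R : Cube n).toSet.indicator (fun _ => a R) x := by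
  induction N generalizing Q with
  | zero => exact absurd hx hN
  | succ N ih =>
    by_cases hxU : x ∈ ⋃ P ∈ ch Q, P.toSet
    · obtain ⟨P, hP, hxP⟩ := mem_iUnion₂.1 hxU
      have hPQ : P ∈ tree ch Q := Relation.ReflTransGen.single hP
      have hsub := tree_subset_tree hPQ
      have h3 := ih (fun R hR => h1 R (hsub hR)) (fun R hR => h2 R (hsub hR)) hxP
        fun h => hN (mem_iUnion₂.2 ⟨P, hP, h⟩)
      have hd : Disjoint ({Q} : Set (Cube n)) (tree ch P) :=
        disjoint_singleton_left.2 (notMem_tree_of_mem hch hvol hP)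
      refine (h2 Q (self_mem_tree Q) P hP hxP).trans ((add_le_add_right h3 _).trans ?_)
      have h4 : ({Q} : Set (Cube n)) ∪ tree ch P ⊆ tree ch Q :=
        union_subset (singleton_subset_iff.2 (self_mem_tree Q)) hsub
      refine le_trans (le_of_eq ?_) (ENNReal.tsum_mono_subtype
        (fun R : Cube n => R.toSet.indicator (fun _ => a R) x) h4)
      rw [Summable.tsum_union_disjoint
        (f := fun R : Cube n => R.toSet.indicator (fun _ => a R) x) hd ENNReal.summable ENNReal.summable,
        tsum_singleton Q fun R : Cube n => R.toSet.indicator (fun _ => a R) x,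
        indicator_of_mem hx]
    · refine (h1 Q (self_mem_tree Q) ⟨hx, hxU⟩).trans (le_trans (le_of_eq ?_)
        (ENNReal.le_tsum (⟨Q, self_mem_tree Q⟩ : tree ch Q)))
      rw [indicator_of_mem hx]

/-- Integrated form of the iteration along a tree of cubes. -/
theorem setLIntegral_le_tsum_tree (hch : ∀ Q, ch Q ⊆ Q.descendants)
    (hdisj : ∀ Q, (ch Q).PairwiseDisjoint Cube.toSet)
    (hvol : ∀ Q, 2 * volume (⋃ P ∈ ch Q, P.toSet) ≤ Q.vol)
    {u a : Cube n → (Fin n → ℝ) → ℝ≥0∞} {v : (Fin n → ℝ) → ℝ≥0∞} (hv : AEMeasurable v volume)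
    (ha : ∀ Q, AEMeasurable (a Q) volume)
    (h : ∀ Q, ∀ᵐ x, (x ∈ Q.toSet \ ⋃ P ∈ ch Q, P.toSet → u Q x ≤ a Q x) ∧
      ∀ P ∈ ch Q, x ∈ P.toSet → u Q x ≤ a Q x + u P x) (Q : Cube n) :
    ∫⁻ x in Q.toSet, u Q x * v x ≤ ∑' R : tree ch Q, ∫⁻ x in (R : Cube n).toSet, a R x * v x := by
  have hc : (tree ch Q).Countable :=
    Cube.countable_of_subset_descendants (tree_subset_descendants hch Q)
  have := hc.to_subtype
  -- Generation N has measure at most 2^-N |Q|, so almost every point leaves the tree after finitely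
  -- many steps and the recursion terminates there.
  have hgen : volume (⋂ N, generation ch N Q) = 0 := by
    have h1 : ∀ N : ℕ, volume (⋂ N, generation ch N Q) ≤ Q.vol * (2⁻¹) ^ N := by
      intro N
      rw [← ENNReal.inv_pow, ← div_eq_mul_inv, ENNReal.le_div_iff_mul_le (by simp) (by simp),
        mul_comm]
      refine le_trans ?_ (two_pow_mul_volume_generation_le hch hdisj hvol N Q)
      gcongr
      exact iInter_subset _ N
    have h2 : Filter.Tendsto (fun N : ℕ => Q.vol * (2⁻¹ : ℝ≥0∞) ^ N) Filter.atTop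
        (nhds (Q.vol * 0)) :=
      ENNReal.Tendsto.const_mul (ENNReal.tendsto_pow_atTop_nhds_zero_of_lt_one (by simp))
        (Or.inr Q.vol_ne_top)
    rw [mul_zero] at h2
    exact le_antisymm (ge_of_tendsto' h2 h1) zero_le
  have hm : ∀ R : tree ch Q, AEMeasurable
      (fun x => (R : Cube n).toSet.indicator (fun x => a R x * v x) x) (volume.restrict Q.toSet) :=
    fun R => (((ha R).mul hv).indicator (R : Cube n).measurableSet_toSet).restrict
  calc ∫⁻ x in Q.toSet, u Q x * v x
      ≤ ∫⁻ x in Q.toSet, ∑' R : tree ch Q,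
          (R : Cube n).toSet.indicator (fun x => a R x * v x) x := by
        refine lintegral_mono_ae ((ae_restrict_iff' Q.measurableSet_toSet).2 ?_)
        filter_upwards [(ae_ball_iff hc).2 fun R _ => h R,
          measure_eq_zero_iff_ae_notMem.1 hgen] with x hx hxN hxQ
        obtain ⟨N, hN⟩ : ∃ N, x ∉ generation ch N Q := by simpa using hxN
        have h1 := le_tsum_tree (u := fun R => u R x) (a := fun R => a R x) hch hvol
          (fun R hR => (hx R hR).1) (fun R hR => (hx R hR).2) N hxQ hN
        refine (mul_le_mul_left h1 _).trans (le_of_eq ?_)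
        rw [← ENNReal.tsum_mul_right]
        refine tsum_congr fun R => ?_
        by_cases hxR : x ∈ (R : Cube n).toSet <;> simp [hxR]
    _ = ∑' R : tree ch Q, ∫⁻ x in Q.toSet,
          (R : Cube n).toSet.indicator (fun x => a R x * v x) x := lintegral_tsum hm
    _ = _ := by
        refine tsum_congr fun R => ?_
        rw [lintegral_indicator (R : Cube n).measurableSet_toSet,
          Measure.restrict_restrict (R : Cube n).measurableSet_toSet,
          inter_eq_left.2 (Cube.subset_of_mem_descendants (tree_subset_descendants hch Q R.2))]

end Tree

/-! ### Passage from the tree to a sparse family in one lattice -/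

/-- The triples of a sparse family of dyadic subcubes of one cube split into `3ⁿ` sparse families in
dyadic lattices; one of them carries a proportion `3⁻ⁿ` of any given sum. -/
theorem exists_sparse_lattice_family {Q : Cube n} {F : Set (Cube n)} (hF : F ⊆ Q.descendants)
    {E : Cube n → Set (Fin n → ℝ)} (hE : ∀ R ∈ F, MeasurableSet (E R) ∧ E R ⊆ R.toSet ∧
      R.vol ≤ 2 * volume (E R)) (hdisj : F.PairwiseDisjoint E) (t : Cube n → ℝ≥0∞) :
    ∃ D S : Set (Cube n), IsDyadicLattice D ∧ S ⊆ D ∧ IsSparse (1 / (2 * 3 ^ n)) S ∧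
      ∑' R : F, t (R : Cube n).triple ≤ 3 ^ n * ∑' R : S, t R := by
  let Fj : (Fin n → Fin 3) → Set (Cube n) := fun j =>
    {R ∈ F | R.triple ∈ (Q.shifted j).descendants}
  -- Pigeonhole: the best of the 3^n shifts is kept, at the cost of the factor 3^n.
  obtain ⟨j, -, hj⟩ := Finset.exists_max_image Finset.univ
    (fun j => ∑' R : Fj j, t (R : Cube n).triple) Finset.univ_nonempty
  obtain ⟨D, hD, hjD⟩ := (Q.shifted j).exists_lattice
  refine ⟨D, Cube.triple '' Fj j, hD, ?_, ?_, ?_⟩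
  · rintro _ ⟨R, hR, rfl⟩
    exact hD.descendants_subset _ hjD hR.2
  -- The set attached to 3R is the one attached to R; its share drops from 1/2 to 1/(2·3^n).
  · refine ⟨Function.extend Cube.triple E fun _ => ∅, ?_, ?_⟩
    · rintro _ ⟨R, hR, rfl⟩
      obtain ⟨h1, h2, h3⟩ := hE R hR.1
      rw [Cube.triple_injective.extend_apply]
      refine ⟨h1, h2.trans R.subset_triple, ?_⟩
      have e : ENNReal.ofReal (1 / (2 * 3 ^ n)) = 2⁻¹ * (3 ^ n)⁻¹ := by
        rw [one_div, mul_inv, ENNReal.ofReal_mul (by positivity),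
          ENNReal.ofReal_inv_of_pos (by positivity), ENNReal.ofReal_inv_of_pos (by positivity),
          ENNReal.ofReal_pow zero_le_three]
        simp
      rw [Cube.vol_triple, e, ← mul_assoc, mul_assoc 2⁻¹,
        ENNReal.inv_mul_cancel (by simp) (by simp), mul_one]
      calc 2⁻¹ * R.vol ≤ 2⁻¹ * (2 * volume (E R)) := by gcongr
        _ = volume (E R) := by
          rw [← mul_assoc, ENNReal.inv_mul_cancel (by simp) (by simp), one_mul]
    · rintro _ ⟨R, hR, rfl⟩ _ ⟨R', hR', rfl⟩ hne
      simp only [Function.onFun]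
      rw [Cube.triple_injective.extend_apply, Cube.triple_injective.extend_apply]
      exact hdisj hR.1 hR'.1 fun h => hne (h ▸ rfl)
  · rw [tsum_image t Cube.triple_injective.injOn]
    have hcov : F ⊆ ⋃ i ∈ (Finset.univ : Finset (Fin n → Fin 3)), Fj i := by
      intro R hR
      obtain ⟨i, hi⟩ := Cube.exists_triple_mem_descendants_shifted (hF hR)
      exact mem_iUnion₂.2 ⟨i, Finset.mem_univ _, hR, hi⟩
    calc ∑' R : F, t (R : Cube n).triple
        ≤ ∑' R : ⋃ i ∈ (Finset.univ : Finset (Fin n → Fin 3)), Fj i, t (R : Cube n).triple :=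
          ENNReal.tsum_mono_subtype (fun R : Cube n => t R.triple) hcov
      _ ≤ ∑ i, ∑' R : Fj i, t (R : Cube n).triple :=
          ENNReal.tsum_biUnion_le (fun R : Cube n => t R.triple) _ _
      _ ≤ ∑ _i : Fin n → Fin 3, ∑' R : Fj j, t (R : Cube n).triple :=
          Finset.sum_le_sum fun i hi => hj i hi
      _ = _ := by simp

end SparseDom

/-! ### Assembly, and the case of an undefined commutator -/

namespace SparseDom

variable {n : ℕ} {𝕜 : Type*} [RCLike 𝕜] {p q q' r : ℝ≥0∞} {α : ℝ} {φT φM : ℝ → ℝ≥0}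
  {T : ((Fin n → ℝ) → 𝕜) → (Fin n → ℝ) → 𝕜} {b f g : (Fin n → ℝ) → 𝕜} {m : ℕ}

theorem sparseForms_eq_tsum (S : Set (Cube n)) :
    sparseForms S b m p r α f g = ∑' Q : S, formTerm b m p r α f g Q := by
  simp only [sparseForms, formTerm]
  rw [ENNReal.tsum_add]

theorem exists_cube_of_isCompact {K : Set (Fin n → ℝ)} (hK : IsCompact K) :
    ∃ Q : Cube n, K ⊆ Q.toSet := by
  obtain ⟨D, hD, -⟩ := (⟨0, 1, one_pos⟩ : Cube n).exists_lattice
  obtain ⟨Q, -, hQ⟩ := hD.exhausts K hK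
  exact ⟨Q, hQ⟩

/-- Sparse domination when the commutator is well defined. -/
theorem exists_sparse_domination [ENNReal.HolderConjugate q q'] (hp : 1 ≤ p) (hpt : p ≠ ∞)
    (hq' : q' ≠ ∞) (hα : 0 ≤ α) (hT : IsSublinear p T)
    (hφT : IsLocallyWeakBounded p α φT (fun f x => ‖T f x‖ₑ))
    (hφM : IsLocallyWeakBounded p α φM (sharpMaximal T q))
    (hb : AEStronglyMeasurable b volume) (hf : AEStronglyMeasurable f volume)
    (hg : AEStronglyMeasurable g volume)
    (hbf : ∀ c : 𝕜, ∀ k ≤ m, BddSuppLp p fun y => (b y - c) ^ k * f y)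
    {Q : Cube n} (hfQ : Function.support f ⊆ Q.toSet) (hgQ : Function.support g ⊆ Q.toSet) :
    ∃ D S : Set (Cube n), IsDyadicLattice D ∧ S ⊆ D ∧ IsSparse (1 / (2 * 3 ^ n)) S ∧
      ∫⁻ x, ‖commutator T b m f x‖ₑ * ‖g x‖ₑ ≤
        3 ^ n * (2 ^ m * (2 + avgGrowth n m) * (φT (weakLevel n m) + φM (weakLevel n m))) *
          sparseForms S b m p q' α f g := by
  choose ch hch hdisj hvol a ha hrec hint using
    exists_stopping_family (m := m) hp hpt hq' hα hT hφT hφM hb hf hg hbf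
  set c : ℝ≥0∞ := 2 ^ m * (2 + avgGrowth n m) * (φT (weakLevel n m) + φM (weakLevel n m)) with hc
  obtain ⟨D, S, hD, hSD, hS, hsum⟩ := exists_sparse_lattice_family (tree_subset_descendants hch Q)
    (E := fun R => R.toSet \ ⋃ P ∈ ch R, P.toSet) (fun R _ => by
      have hU := measurableSet_biUnion_toSet (Cube.countable_of_subset_descendants (hch R))
      refine ⟨R.measurableSet_toSet.diff hU, sdiff_subset, ?_⟩
      have h1 : R.vol ≤ volume (R.toSet \ ⋃ P ∈ ch R, P.toSet) +
          volume (⋃ P ∈ ch R, P.toSet) :=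
        (measure_mono (by rw [sdiff_union_self]; exact subset_union_left)).trans
          (measure_union_le _ _)
      refine (ENNReal.add_le_add_iff_right R.vol_ne_top).1 ?_
      calc R.vol + R.vol = 2 * R.vol := by ring
        _ ≤ 2 * (volume (R.toSet \ ⋃ P ∈ ch R, P.toSet) + volume (⋃ P ∈ ch R, P.toSet)) := by
          gcongr
        _ = 2 * volume (R.toSet \ ⋃ P ∈ ch R, P.toSet) +
            2 * volume (⋃ P ∈ ch R, P.toSet) := by ring
        _ ≤ _ := by gcongr; exact hvol R)
    (pairwiseDisjoint_tree hch hdisj Q) (formTerm b m p q' α f g)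
  refine ⟨D, S, hD, hSD, hS, ?_⟩
  have hfi : Q.triple.toSet.indicator f = f :=
    indicator_eq_self.2 (hfQ.trans Q.subset_triple)
  have hloc : ∫⁻ x, ‖commutator T b m f x‖ₑ * ‖g x‖ₑ =
      ∫⁻ x in Q.toSet, ‖commutator T b m (Q.triple.toSet.indicator f) x‖ₑ * ‖g x‖ₑ := by
    rw [hfi, ← lintegral_indicator Q.measurableSet_toSet]
    congr 1
    symm
    rw [indicator_eq_self]
    intro x hx
    refine hgQ fun h => hx ?_
    simp [h]
  rw [hloc, sparseForms_eq_tsum]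
  calc _ ≤ ∑' R : tree ch Q, ∫⁻ x in (R : Cube n).toSet, a R x * ‖g x‖ₑ :=
        setLIntegral_le_tsum_tree
          (u := fun R x => ‖commutator T b m (R.triple.toSet.indicator f) x‖ₑ) hch hdisj hvol
          hg.enorm ha hrec Q
    _ ≤ ∑' R : tree ch Q, c * formTerm b m p q' α f g (R : Cube n).triple :=
        ENNReal.tsum_le_tsum fun R => hint R
    _ = c * ∑' R : tree ch Q, formTerm b m p q' α f g (R : Cube n).triple :=
        ENNReal.tsum_mul_left
    _ ≤ c * (3 ^ n * ∑' R : S, formTerm b m p q' α f g R) := by gcongr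
    _ = _ := by ring

/-- On the support of f, |b|^m is at most 2^m (|b - c|^m + |c|^m), so a finite average of the weight
forces b^m f into L^p. The contrapositive handles the degenerate case. -/
theorem memLp_pow_mul_of_avgNorm_oscWeight_ne_top (hb : AEStronglyMeasurable b volume)
    (hf : MemLp f p volume) {Q : Cube n} (hfQ : Function.support f ⊆ Q.toSet)
    (h : avgNorm p Q (oscWeight b m Q f) ≠ ∞) :
    MemLp (fun x => b x ^ m * f x) p volume := by
  set c := ⨍ y in Q.toSet, b y with hc
  have hw : AEStronglyMeasurable (oscWeight b m Q f) volume :=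
    ((hb.sub (aestronglyMeasurable_const (b := c))).norm.pow m).mul hf.1.norm
  have hw1 : MemLp (oscWeight b m Q f) p (volume.restrict Q.toSet) := by
    have h1 : MemLp (oscWeight b m Q f) p (Q.vol⁻¹ • volume.restrict Q.toSet) :=
      ⟨hw.mono_ac Q.unif_absolutelyContinuous, lt_top_iff_ne_top.2 h⟩
    have h2 := h1.smul_measure Q.vol_ne_top
    rwa [smul_smul, ENNReal.mul_inv_cancel Q.vol_ne_zero Q.vol_ne_top, one_smul] at h2
  have hind : Q.toSet.indicator (fun x => b x ^ m * f x) = fun x => b x ^ m * f x :=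
    indicator_eq_self.2 ((Function.support_mul_subset_right _ _).trans hfQ)
  rw [← hind, memLp_indicator_iff_restrict Q.measurableSet_toSet]
  have hdom : MemLp (fun x => 2 ^ m * (oscWeight b m Q f x + ‖c‖ ^ m * ‖f x‖)) p
      (volume.restrict Q.toSet) :=
    (hw1.add ((hf.restrict _).norm.const_mul _)).const_mul _
  refine hdom.mono ((hb.pow m).mul hf.1).restrict (Filter.Eventually.of_forall fun x => ?_)
  have hpos : 0 ≤ oscWeight b m Q f x := by unfold oscWeight; positivity
  rw [norm_mul, norm_pow, Real.norm_of_nonneg (by positivity), oscWeight, ← hc, ← add_mul,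
    ← mul_assoc]
  gcongr
  have h1 : ‖b x‖ ≤ ‖b x - c‖ + ‖c‖ := by
    have := norm_add_le (b x - c) c
    rwa [sub_add_cancel] at this
  calc ‖b x‖ ^ m ≤ (‖b x - c‖ + ‖c‖) ^ m := by gcongr
    _ ≤ 2 ^ (m - 1) * (‖b x - c‖ ^ m + ‖c‖ ^ m) := add_pow_le (norm_nonneg _) (norm_nonneg _) m
    _ ≤ 2 ^ m * (‖b x - c‖ ^ m + ‖c‖ ^ m) := by
        gcongr
        · norm_num
        · omega

theorem ae_eq_zero_of_avgNorm_eq_zero (hr : r ≠ 0) (hg : AEStronglyMeasurable g volume)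
    {Q : Cube n} (hgQ : Function.support g ⊆ Q.toSet) (h : avgNorm r Q g = 0) :
    g =ᵐ[volume] 0 := by
  rw [avgNorm_eq_eLpNorm_unif,
    eLpNorm_eq_zero_iff (hg.mono_ac Q.unif_absolutelyContinuous) hr] at h
  have h1 : g =ᵐ[volume.restrict Q.toSet] 0 :=
    (Measure.absolutelyContinuous_smul (ENNReal.inv_ne_zero.2 Q.vol_ne_top)).ae_le h
  filter_upwards [(ae_restrict_iff' Q.measurableSet_toSet).1 h1] with x hx
  by_cases hxQ : x ∈ Q.toSet
  · exact hx hxQ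
  · exact Function.notMem_support.1 fun h => hxQ (hgQ h)

theorem isSparse_singleton (Q : Cube n) : IsSparse (1 / (2 * 3 ^ n)) {Q} := by
  refine ⟨Cube.toSet, ?_, pairwiseDisjoint_singleton _ _⟩
  rintro _ rfl
  refine ⟨Cube.measurableSet_toSet _, Subset.rfl, mul_le_of_le_one_left' ?_⟩
  rw [← ENNReal.ofReal_one]
  refine ENNReal.ofReal_le_ofReal ((div_le_one (by positivity)).2 ?_)
  have : (1 : ℝ) ≤ 3 ^ n := one_le_pow₀ (by norm_num)
  linarith

/-- The average of |b - ⟨b⟩|^m |f| is infinite, and g ≠ 0 prevents the product with the average of g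
from collapsing to 0. -/
theorem sparseForms_singleton_eq_top (hr : r ≠ 0) (hb : AEStronglyMeasurable b volume)
    (hf : MemLp f p volume) (hg : AEStronglyMeasurable g volume) {Q : Cube n}
    (hfQ : Function.support f ⊆ Q.toSet) (hgQ : Function.support g ⊆ Q.toSet)
    (hbf : ¬ MemLp (fun x => b x ^ m * f x) p volume) (hg0 : ¬ g =ᵐ[volume] 0) :
    sparseForms {Q} b m p r α f g = ∞ := by
  have h1 : avgNorm p Q (oscWeight b m Q f) = ∞ := by
    by_contra h
    exact hbf (memLp_pow_mul_of_avgNorm_oscWeight_ne_top hb hf hfQ h)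
  have h2 : avgNorm r Q g ≠ 0 := fun h => hg0 (ae_eq_zero_of_avgNorm_eq_zero hr hg hgQ h)
  have h3 : Q.vol ^ (1 + α / n) ≠ 0 := by
    simp [ENNReal.rpow_eq_zero_iff, Q.vol_ne_zero, Q.vol_ne_top]
  rw [sparseForms_eq_tsum, tsum_singleton Q (formTerm b m p r α f g), formTerm, h1,
    ENNReal.top_mul h2, ENNReal.top_mul h3, top_add]

end SparseDom

theorem theorem1p5 (n : ℕ) (hn : 1 ≤ n) (m : ℕ) :
    ∃ C lam : ℝ, 1 < C ∧ 0 < lam ∧ lam < 1 ∧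
      ∀ (𝕜 : Type) [RCLike 𝕜] (p₀ q₀ q₀' : ℝ≥0∞) (α : ℝ)
        (T : ((Fin n → ℝ) → 𝕜) → (Fin n → ℝ) → 𝕜) (φT φM : ℝ → ℝ≥0),
        1 ≤ p₀ → p₀ < q₀ → ENNReal.HolderConjugate q₀ q₀' →
        0 ≤ α → α < n / p₀.toReal →
        SparseDom.IsSublinear p₀ T →
        SparseDom.IsLocallyWeakBounded p₀ α φT (fun f x => ‖T f x‖ₑ) →
        SparseDom.IsLocallyWeakBounded p₀ α φM (SparseDom.sharpMaximal T q₀) →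
        ∀ f g b : (Fin n → ℝ) → 𝕜,
          MemLp f ∞ volume → HasCompactSupport f →
          MemLp g ∞ volume → HasCompactSupport g →
          LocallyIntegrable b volume →
          ∃ D S : Set (SparseDom.Cube n),
            SparseDom.IsDyadicLattice D ∧ S ⊆ D ∧
            SparseDom.IsSparse (1 / (2 * 3 ^ n)) S ∧
            ((∫⁻ x, ‖SparseDom.commutator T b m f x‖ₑ * ‖g x‖ₑ
                ≤ ENNReal.ofReal (C * (φT lam + φM lam)) *
                  SparseDom.sparseForms S b m p₀ q₀' α f g) ∨
              -- only needed for the product `0 * ∞`: here `T_b^m f` may be undefined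
              (¬ MemLp (fun x => b x ^ m * f x) p₀ volume ∧
                SparseDom.sparseForms S b m p₀ q₀' α f g = ∞)) := by
  have hC : (1 : ℝ) < 3 ^ n * (2 ^ m * (2 + SparseDom.avgGrowth n m)) := by
    have h1 : (1 : ℝ) ≤ 3 ^ n := one_le_pow₀ (by norm_num)
    have h2 : (1 : ℝ) ≤ 2 ^ m := one_le_pow₀ (by norm_num)
    have h3 : (1 : ℝ) < 2 + SparseDom.avgGrowth n m := by
      linarith [(Nat.cast_nonneg (SparseDom.avgGrowth n m) : (0 : ℝ) ≤ _)]
    exact one_lt_mul_of_le_of_lt h1 (one_lt_mul_of_le_of_lt h2 h3)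
  refine ⟨3 ^ n * (2 ^ m * (2 + SparseDom.avgGrowth n m)), SparseDom.weakLevel n m, hC,
    SparseDom.weakLevel_pos n m, SparseDom.weakLevel_lt_one n m, ?_⟩
  intro 𝕜 _ p₀ q₀ q₀' α T φT φM hp hpq hqq hα _ hT hφT hφM f g b hf hfs hg hgs hb
  have hpt : p₀ ≠ ∞ := hpq.ne_top
  -- Here q₀ > p₀ ≥ 1, and the conjugate exponent is infinite only for q₀ = 1.
  have hq' : q₀' ≠ ∞ := by
    rintro rfl
    exact (hp.trans_lt hpq).ne' ((ENNReal.HolderConjugate.eq_top_iff_eq_one ∞ q₀).1 rfl)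
  have hq1 : 1 ≤ q₀' := ENNReal.HolderConjugate.one_le q₀' q₀
  have hbm := hb.aestronglyMeasurable
  have hfp : MemLp f p₀ volume :=
    hf.mono_exponent_of_measure_support_ne_top (s := tsupport f)
      (fun x hx => image_eq_zero_of_notMem_tsupport hx) hfs.isCompact.measure_lt_top.ne le_top
  obtain ⟨Q, hQ⟩ := SparseDom.exists_cube_of_isCompact (hfs.isCompact.union hgs.isCompact)
  have hfQ : Function.support f ⊆ Q.toSet :=
    (subset_tsupport f).trans (subset_union_left.trans hQ)
  have hgQ : Function.support g ⊆ Q.toSet :=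
    (subset_tsupport g).trans (subset_union_right.trans hQ)
  by_cases hbf : MemLp (fun x => b x ^ m * f x) p₀ volume
  · obtain ⟨D, S, hD, hSD, hS, h⟩ := SparseDom.exists_sparse_domination (m := m) hp hpt hq' hα hT
      hφT hφM hbm hf.1 hg.1
      (fun c k hk => SparseDom.bddSuppLp_sub_pow_mul hbm hfp hfs hbf c hk) hfQ hgQ
    refine ⟨D, S, hD, hSD, hS, Or.inl (h.trans (le_of_eq ?_))⟩
    congr 1
    rw [ENNReal.ofReal_mul (by positivity), ENNReal.ofReal_mul (by positivity),
      ENNReal.ofReal_mul (by positivity), ENNReal.ofReal_pow zero_le_three,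
      ENNReal.ofReal_pow zero_le_two, ENNReal.ofReal_add zero_le_two (by positivity),
      ENNReal.ofReal_natCast, ENNReal.ofReal_add (by positivity) (by positivity),
      ENNReal.ofReal_coe_nnreal, ENNReal.ofReal_coe_nnreal]
    simp
    ring
  · obtain ⟨D, hD, hQD⟩ := Q.exists_lattice
    refine ⟨D, {Q}, hD, singleton_subset_iff.2 hQD, SparseDom.isSparse_singleton Q, ?_⟩
    -- If g vanishes almost everywhere, the left-hand side is 0 whatever the commutator means;
    -- otherwise the one-cube family already gives an infinite sum.
    by_cases hg0 : g =ᵐ[volume] 0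
    · left
      rw [lintegral_congr_ae (g := 0) (by filter_upwards [hg0] with x hx; simp [hx])]
      simp
    · exact Or.inr ⟨hbf, SparseDom.sparseForms_singleton_eq_top (zero_lt_one.trans_le hq1).ne' hbm
        hfp hg.1 hfQ hgQ hbf hg0⟩
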